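/- Let $d\ge 1$ and $0<r,R<\infty$. A closed set $\omega\subset\mathbb{R}^d$ is an $(r,R)$-set if $\|x-y\|\ge r$ for all distinct $x,y\in\omega$ and every closed ball of radius $R$ meets $\omega$. On the closed subsets of $\mathbb{R}^d$ consider the translations $T_tF=F+t$ and the natural topology, in which the sets $\{G: d_k(F,G)\le\varepsilon\}$, $\varepsilon>0$, $k\in\mathbb{N}$, form a neighbourhood basis at $F$, where $$d_k(F,G)=\inf\big(\{\varepsilon>0: F\cap B_k\subset U_\varepsilon(G),\ G\cap B_k\subset U_\varepsilon(F)\}\cup\{1\}\big),$$ $B_k$ is the closed ball of radius $k$ around $0$ and $U_\varepsilon$ denotes the open $\varepsilon$-neighbourhood. Let $\Omega$ be a translation invariant set of $(r,R)$-sets that is closed in the natural topology, and let $\mu$ be a translation invariant ergodic Borel probability measure on $\Omega$. Let $\mathcal{X}=\{(\omega,x):\omega\in\Omega,\ x\in\omega\}\subset\Omega\times\mathbb{R}^d$. Let $A=(A_\omega)_{\omega\in\Omega}$ be a family of bounded operators $A_\omega:\ell^2(\omega)\to\ell^2(\omega)$ which is - covariant: $A_{\omega+t}=U_tA_\omega U_t^*$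 for all $\omega\in\Omega$, $t\in\mathbb{R}^d$, where $U_t:\ell^2(\omega)\to\ell^2(\omega+t)$, $(U_tf)(x)=f(x-t)$; - measurable: $\omega\mapsto\langle f(\omega),A_\omega g(\omega)\rangle$ is measurable for all Borel measurable $f,g:\mathcal{X}\to\mathbb{C}$ with $f(\omega)=f(\omega,\cdot)\in\ell^2(\omega)$ and $g(\omega)=g(\omega,\cdot)\in\ell^2(\omega)$ for every $\omega\in\Omega$; - bounded: $\sup_{\omega\in\Omega}\|A_\omega\|<\infty$; and suppose that $A_\omega$ is selfadjoint for $\mu$-almost every $\omega$. For a bounded selfadjoint operator $B$ and $\bullet=ac,sc,pp$ let $\sigma_\bullet(B)$ be the spectrum of the restriction of $B$ to the subspace of all vectors whose spectral measure is absolutely continuous, singular continuous, or pure point, respectively. Let $\sigma_{disc}(B)$ be the set of isolated points of $\sigma(B)$ that are eigenvalues of finite multiplicity, and let $\sigma_{ess}(B)=\sigma(B)\setminus\sigma_{disc}(B)$. Then there exist sets $\Sigma,\Sigma_{ac},\Sigma_{sc},\Sigma_{pp},\Sigma_{ess}\subset\mathbb{R}$ and a subset $\widetilde\Omega\subset\Omega$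 of full $\mu$-measure such that for every $\omega\in\widetilde\Omega$ $$\sigma(A_\omega)=\Sigma,\qquad \sigma_\bullet(A_\omega)=\Sigma_\bullet\ \ (\bullet=ac,sc,pp,ess),\qquad \sigma_{disc}(A_\omega)=\emptyset .$$ -/

import Mathlib

open MeasureTheory Filter Topology
open scoped CompactlySupported

namespace DeloneOp

/-! ### Spectral theory of a bounded self-adjoint operator -/

section Spectral

variable {H : Type*} [NormedAddCommGroup H] [InnerProductSpace ℂ H] [CompleteSpace H]

/-- The positive functional `f ↦ ⟨v, f(T) v⟩` on `C_c(ℝ)`, where `f(T)` is the continuous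
functional calculus of the self-adjoint operator `T` (for `T` not self-adjoint, it is zero). -/
noncomputable def spectralFunctional (T : H →L[ℂ] H) (v : H) : C_c(ℝ, ℝ) →ₚ[ℝ] ℝ :=
  PositiveLinearMap.mk₀
    { toFun := fun f => (inner ℂ v (cfc (f : ℝ → ℝ) T v)).re
      map_add' := fun f g => by
        have h : cfc (⇑(f + g)) T = cfc (⇑f) T + cfc (⇑g) T :=
          cfc_add (a := T) f g f.continuous.continuousOn g.continuous.continuousOn
        have h2 : (cfc (⇑f) T + cfc (⇑g) T) v = cfc (⇑f) T v + cfc (⇑g) T v := rfl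
        rw [h, h2, inner_add_right, Complex.add_re]
      map_smul' := fun c f => by
        have h : cfc (⇑(c • f)) T = c • cfc (⇑f) T :=
          cfc_smul c (⇑f) T f.continuous.continuousOn
        have h2 : (c • cfc (⇑f) T) v = (c : ℂ) • (cfc (⇑f) T v) := by
          simp
        rw [h, h2, inner_smul_right]
        simp }
    (fun f hf => by
      have h : 0 ≤ cfc (⇑f) T := cfc_nonneg fun x _ => hf x
      rw [ContinuousLinearMap.nonneg_iff_isPositive] at h
      exact h.re_inner_nonneg_right v)

/-- The spectral measure `μ_v` of the self-adjoint operator `T` at the vector `v`: the Borel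
measure on `ℝ` with `∫ f dμ_v = ⟨v, f(T) v⟩`. -/
noncomputable def spectralMeasure (T : H →L[ℂ] H) (v : H) : Measure ℝ :=
  RealRMK.rieszMeasure (spectralFunctional T v)

instance spectralMeasure_regular (T : H →L[ℂ] H) (v : H) : (spectralMeasure T v).Regular :=
  RealRMK.regular_rieszMeasure _

theorem integral_spectralMeasure (T : H →L[ℂ] H) (v : H) (f : C_c(ℝ, ℝ)) :
    ∫ x, f x ∂(spectralMeasure T v) = (inner ℂ v (cfc (f : ℝ → ℝ) T v)).re :=
  RealRMK.integral_rieszMeasure (spectralFunctional T v) f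

theorem spectralMeasure_zero (T : H →L[ℂ] H) : spectralMeasure T 0 = 0 := by
  refine Measure.ext_of_integral_eq_on_compactlySupported fun f => ?_
  rw [integral_spectralMeasure]
  simp

theorem spectralMeasure_smul_ac (T : H →L[ℂ] H) (c : ℂ) (v : H) :
    spectralMeasure T (c • v) ≪ spectralMeasure T v := by
  have h : spectralMeasure T (c • v) = (‖c‖₊ ^ 2) • spectralMeasure T v := by
    refine Measure.ext_of_integral_eq_on_compactlySupported fun f => ?_
    rw [integral_smul_nnreal_measure, integral_spectralMeasure, integral_spectralMeasure,
      map_smul, inner_smul_left, inner_smul_right, ← mul_assoc, Complex.conj_mul']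
    rw [← Complex.ofReal_pow, Complex.re_ofReal_mul]
    rfl
  rw [h]
  exact Measure.smul_absolutelyContinuous

theorem spectralMeasure_add_ac (T : H →L[ℂ] H) (u v : H) :
    spectralMeasure T (u + v) ≪ spectralMeasure T u + spectralMeasure T v := by
  have h : spectralMeasure T (u + v) + spectralMeasure T (u - v)
      = (2 : NNReal) • (spectralMeasure T u + spectralMeasure T v) := by
    have hloc : ∀ a b : H, IsLocallyFiniteMeasure (spectralMeasure T a + spectralMeasure T b) :=
      fun a b => by
        have : IsFiniteMeasureOnCompacts (spectralMeasure T a + spectralMeasure T b) :=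
          ⟨fun K hK => by
            rw [Measure.add_apply]
            exact ENNReal.add_lt_top.2 ⟨hK.measure_lt_top, hK.measure_lt_top⟩⟩
        exact isLocallyFiniteMeasure_of_isFiniteMeasureOnCompacts
    have h₁ := hloc (u + v) (u - v)
    have h₂ := hloc u v
    refine Measure.ext_of_integral_eq_on_compactlySupported fun f => ?_
    rw [integral_add_measure f.integrable f.integrable, integral_smul_nnreal_measure,
      integral_add_measure f.integrable f.integrable]
    simp only [integral_spectralMeasure, map_add, map_sub, inner_add_left, inner_add_right,
      inner_sub_left, inner_sub_right, Complex.add_re, Complex.sub_re, NNReal.smul_def]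
    simp only [NNReal.coe_ofNat, smul_eq_mul]
    ring
  have h1 : spectralMeasure T (u + v) ≪ spectralMeasure T (u + v) + spectralMeasure T (u - v) :=
    Measure.AbsolutelyContinuous.rfl.add_right _
  rw [h] at h1
  exact h1.trans Measure.smul_absolutelyContinuous

theorem spectralMeasure_apply_ac (T : H →L[ℂ] H) (v : H) :
    spectralMeasure T (T v) ≪ spectralMeasure T v := by
  by_cases hT : IsSelfAdjoint T
  · have h : spectralMeasure T (T v)
        = (spectralMeasure T v).withDensity (fun x => ENNReal.ofReal (x ^ 2)) := by
      have : IsLocallyFiniteMeasure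
          ((spectralMeasure T v).withDensity (fun x => ENNReal.ofReal (x ^ 2))) :=
        IsLocallyFiniteMeasure.withDensity_ofReal (by fun_prop)
      refine Measure.ext_of_integral_eq_on_compactlySupported fun f => ?_
      rw [integral_withDensity_eq_integral_toReal_smul (by fun_prop) (by simp)]
      let g : C_c(ℝ, ℝ) :=
        { toFun := fun x => x * f x * x
          continuous_toFun := by fun_prop
          hasCompactSupport' := (f.hasCompactSupport.mul_left (f := fun x => x)).mul_right }
      have hg : ∀ x : ℝ, (ENNReal.ofReal (x ^ 2)).toReal • f x = g x := fun x => by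
        rw [ENNReal.toReal_ofReal (sq_nonneg x)]
        change x ^ 2 * f x = x * f x * x
        ring
      simp_rw [hg]
      rw [integral_spectralMeasure, integral_spectralMeasure]
      have hc : cfc (⇑g) T = T * cfc (⇑f) T * T := by
        have e1 : cfc (⇑g) T = cfc (fun x => x * f x) T * cfc (fun x : ℝ => x) T :=
          cfc_mul (fun x => x * f x) (fun x : ℝ => x) T
            (by fun_prop) (by fun_prop)
        have e2 : cfc (fun x => x * f x) T = cfc (fun x : ℝ => x) T * cfc (⇑f) T :=
          cfc_mul (fun x : ℝ => x) (⇑f) T (by fun_prop) f.continuous.continuousOn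
        rw [e1, e2, cfc_id' ℝ T]
      rw [hc]
      have := hT.isSymmetric v (cfc (⇑f) T (T v))
      simp only [ContinuousLinearMap.coe_coe] at this
      rw [this]
      rfl
    rw [h]
    exact withDensity_absolutelyContinuous _ _
  · have h : spectralMeasure T (T v) = 0 := by
      refine Measure.ext_of_integral_eq_on_compactlySupported fun f => ?_
      rw [integral_spectralMeasure, cfc_apply_of_not_predicate T hT]
      simp
    rw [h]
    exact Measure.AbsolutelyContinuous.zero _

/-- The subspace of all vectors whose spectral measure belongs to a class `P` of measures that
contains `0` and is closed under sums and under absolute continuity. -/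
noncomputable def spectralSubspace (T : H →L[ℂ] H) (P : Measure ℝ → Prop) (h0 : P 0)
    (hadd : ∀ ν₁ ν₂, P ν₁ → P ν₂ → P (ν₁ + ν₂)) (hac : ∀ ν₁ ν₂, ν₁ ≪ ν₂ → P ν₂ → P ν₁) :
    Submodule ℂ H where
  carrier := {v | P (spectralMeasure T v)}
  zero_mem' := by simpa [spectralMeasure_zero] using h0
  add_mem' := fun {u v} hu hv => hac _ _ (spectralMeasure_add_ac T u v) (hadd _ _ hu hv)
  smul_mem' := fun c v hv => hac _ _ (spectralMeasure_smul_ac T c v) hv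

/-- The measure `ν` is pure point: it is carried by a countable set. -/
def IsPurePoint (ν : Measure ℝ) : Prop := ∃ S : Set ℝ, S.Countable ∧ ν Sᶜ = 0

/-- The measure `ν` is singular continuous: it has no atoms and is singular with respect to
Lebesgue measure. -/
def IsSingCont (ν : Measure ℝ) : Prop := (∀ x : ℝ, ν {x} = 0) ∧ ν ⟂ₘ (volume : Measure ℝ)

/-- `H_ac`: the vectors with absolutely continuous spectral measure. -/
noncomputable def acSubspace (T : H →L[ℂ] H) : Submodule ℂ H :=
  spectralSubspace T (fun ν => ν ≪ (volume : Measure ℝ)) (Measure.AbsolutelyContinuous.zero _)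
    (fun _ _ h₁ h₂ => h₁.add_left h₂) (fun _ _ h h₂ => h.trans h₂)

/-- `H_sc`: the vectors with singular continuous spectral measure. -/
noncomputable def scSubspace (T : H →L[ℂ] H) : Submodule ℂ H :=
  spectralSubspace T IsSingCont ⟨fun _ => by simp, Measure.MutuallySingular.zero_left⟩
    (fun _ _ h₁ h₂ => ⟨fun x => by simp [h₁.1 x, h₂.1 x], h₁.2.add_left h₂.2⟩)
    (fun _ _ h h₂ => ⟨fun x => h (h₂.1 x), h₂.2.mono_ac h Measure.AbsolutelyContinuous.rfl⟩)

/-- `H_pp`: the vectors with pure point spectral measure. -/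
noncomputable def ppSubspace (T : H →L[ℂ] H) : Submodule ℂ H :=
  spectralSubspace T IsPurePoint ⟨∅, Set.countable_empty, by simp⟩
    (fun ν₁ ν₂ ⟨S₁, c₁, h₁⟩ ⟨S₂, c₂, h₂⟩ => ⟨S₁ ∪ S₂, c₁.union c₂, by
      have a₁ : ν₁ (S₁ ∪ S₂)ᶜ = 0 :=
        measure_mono_null (Set.compl_subset_compl.2 Set.subset_union_left) h₁
      have a₂ : ν₂ (S₁ ∪ S₂)ᶜ = 0 :=
        measure_mono_null (Set.compl_subset_compl.2 Set.subset_union_right) h₂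
      simp only [Measure.add_apply, a₁, a₂, add_zero]⟩)
    (fun _ _ h ⟨S, c, hS⟩ => ⟨S, c, h hS⟩)

/-- The absolutely continuous spectrum: the spectrum of `T` restricted to `H_ac`. -/
noncomputable def acSpectrum (T : H →L[ℂ] H) : Set ℂ :=
  spectrum ℂ (T.restrict (p := acSubspace T) (q := acSubspace T)
    fun v hv => (spectralMeasure_apply_ac T v).trans hv)

/-- The singular continuous spectrum: the spectrum of `T` restricted to `H_sc`. -/
noncomputable def scSpectrum (T : H →L[ℂ] H) : Set ℂ :=
  spectrum ℂ (T.restrict (p := scSubspace T) (q := scSubspace T)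
    fun v hv => ⟨fun x => spectralMeasure_apply_ac T v (hv.1 x),
      hv.2.mono_ac (spectralMeasure_apply_ac T v) Measure.AbsolutelyContinuous.rfl⟩)

/-- The pure point spectrum: the spectrum of `T` restricted to `H_pp` (that is, the closure of
the set of eigenvalues). -/
noncomputable def ppSpectrum (T : H →L[ℂ] H) : Set ℂ :=
  spectrum ℂ (T.restrict (p := ppSubspace T) (q := ppSubspace T)
    fun v ⟨S, c, hS⟩ => ⟨S, c, spectralMeasure_apply_ac T v hS⟩)

/-- The discrete spectrum: isolated points of the spectrum that are eigenvalues of finite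
multiplicity. -/
def discSpectrum (T : H →L[ℂ] H) : Set ℂ :=
  {z | (∃ ε > 0, spectrum ℂ T ∩ Metric.ball z ε = {z}) ∧
    Module.End.HasEigenvalue (T : Module.End ℂ H) z ∧
    FiniteDimensional ℂ (Module.End.eigenspace (T : Module.End ℂ H) z)}

/-- The essential spectrum: the complement of the discrete spectrum in the spectrum. -/
def essSpectrum (T : H →L[ℂ] H) : Set ℂ := spectrum ℂ T \ discSpectrum T

end Spectral

/-! ### Closed subsets of Euclidean space with the natural topology -/

/-- A closed subset of `ℝ^d`. -/
@[ext]
structure ClosedSubset (d : ℕ) where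
  carrier : Set (EuclideanSpace ℝ (Fin d))
  isClosed : IsClosed carrier

/-- `d_k(F, G)`: the infimum of `1` and of all `ε > 0` such that `F ∩ B_k` lies in the open
`ε`-neighbourhood of `G` and `G ∩ B_k` lies in that of `F`. -/
noncomputable def localDist {d : ℕ} (k : ℕ) (F G : ClosedSubset d) : ℝ :=
  sInf ({ε : ℝ | 0 < ε ∧
      F.carrier ∩ Metric.closedBall 0 k ⊆ Metric.thickening ε G.carrier ∧
      G.carrier ∩ Metric.closedBall 0 k ⊆ Metric.thickening ε F.carrier} ∪ {1})

theorem localDist_mono {d : ℕ} {k l : ℕ} (hkl : k ≤ l) (F G : ClosedSubset d) :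
    localDist k F G ≤ localDist l F G := by
  have hb : (Metric.closedBall 0 (k : ℝ) : Set (EuclideanSpace ℝ (Fin d)))
      ⊆ Metric.closedBall 0 (l : ℝ) := Metric.closedBall_subset_closedBall (by exact_mod_cast hkl)
  refine csInf_le_csInf ⟨0, ?_⟩ ⟨1, Or.inr rfl⟩ (Set.union_subset_union_left _ ?_)
  · rintro x (⟨hx, -⟩ | hx)
    · exact hx.le
    · rw [Set.mem_singleton_iff.1 hx]
      exact zero_le_one
  · rintro ε ⟨hε, h₁, h₂⟩
    exact ⟨hε, (Set.inter_subset_inter_right _ hb).trans h₁,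
      (Set.inter_subset_inter_right _ hb).trans h₂⟩

/-- The natural topology: the sets `{G | d_k(F, G) ≤ ε}`, `ε > 0`, `k ∈ ℕ`, form a neighbourhood
basis at `F`. -/
instance naturalTopology (d : ℕ) : TopologicalSpace (ClosedSubset d) where
  IsOpen U := ∀ F ∈ U, ∃ ε > 0, ∃ k : ℕ, {G | localDist k F G ≤ ε} ⊆ U
  isOpen_univ := fun _ _ => ⟨1, one_pos, 0, Set.subset_univ _⟩
  isOpen_inter := fun U V hU hV F hF => by
    obtain ⟨ε, hε, k, h⟩ := hU F hF.1
    obtain ⟨δ, hδ, l, h'⟩ := hV F hF.2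
    refine ⟨min ε δ, lt_min hε hδ, max k l, fun G hG => ⟨h ?_, h' ?_⟩⟩
    · exact (localDist_mono (le_max_left k l) F G).trans (le_trans hG (min_le_left _ _))
    · exact (localDist_mono (le_max_right k l) F G).trans (le_trans hG (min_le_right _ _))
  isOpen_sUnion := fun S hS F ⟨U, hU, hF⟩ => by
    obtain ⟨ε, hε, k, h⟩ := hS U hU F hF
    exact ⟨ε, hε, k, h.trans (Set.subset_sUnion_of_mem hU)⟩

/-- The translation action `T_t G = G + t` of `ℝ^d`. -/
instance translationAction (d : ℕ) : AddAction (EuclideanSpace ℝ (Fin d)) (ClosedSubset d) where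
  vadd t G := ⟨{x | x - t ∈ G.carrier}, G.isClosed.preimage (by fun_prop)⟩
  zero_vadd G := by
    ext x
    change x - 0 ∈ G.carrier ↔ x ∈ G.carrier
    rw [sub_zero]
  add_vadd s t G := by
    ext x
    change x - (s + t) ∈ G.carrier ↔ x - s - t ∈ G.carrier
    rw [sub_sub]

/-- An `(r, R)`-set: distinct points have distance at least `r`, and every closed ball of
radius `R` contains a point. -/
def IsDeloneSet {d : ℕ} (r R : ℝ) (ω : ClosedSubset d) : Prop :=
  (∀ x ∈ ω.carrier, ∀ y ∈ ω.carrier, x ≠ y → r ≤ dist x y) ∧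
    ∀ x, (Metric.closedBall x R ∩ ω.carrier).Nonempty

/-- The translation invariant set `Ω` is an `(r, R)`-system: it is closed in the natural
topology and consists of `(r, R)`-sets. -/
structure IsDeloneSystem {d : ℕ} (r R : ℝ)
    (Ω : SubAddAction (EuclideanSpace ℝ (Fin d)) (ClosedSubset d)) : Prop where
  closed : IsClosed (Ω : Set (ClosedSubset d))
  delone : ∀ ω ∈ Ω, IsDeloneSet r R ω

instance borelClosedSubset (d : ℕ) : MeasurableSpace (ClosedSubset d) := borel _

instance (d : ℕ) : BorelSpace (ClosedSubset d) := ⟨rfl⟩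

/-! ### Random operators -/

/-- The Hilbert space `ℓ²(ω)`. -/
abbrev L2 {d : ℕ} (ω : ClosedSubset d) : Type := lp (fun _ : ω.carrier => ℂ) 2

/-- The bijection `x ↦ x + t` from `ω` to `ω + t`. -/
def translateEquiv {d : ℕ} (t : EuclideanSpace ℝ (Fin d)) (ω : ClosedSubset d) :
    ω.carrier ≃ (t +ᵥ ω).carrier where
  toFun x := ⟨x + t, by
    change (x : EuclideanSpace ℝ (Fin d)) + t - t ∈ ω.carrier
    simp⟩
  invFun x := ⟨x - t, x.2⟩
  left_inv x := by simp
  right_inv x := by simp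

theorem memℓp_comp {α β : Type*} (e : α ≃ β) {f : β → ℂ} (hf : Memℓp f 2) :
    Memℓp (fun a => f (e a)) 2 := by
  rw [memℓp_gen_iff (by norm_num)] at hf ⊢
  exact (e.summable_iff (f := fun b => ‖f b‖ ^ (2 : ENNReal).toReal)).2 hf

/-- The unitary operator `U_t : ℓ²(ω) → ℓ²(ω + t)`, `(U_t f)(x) = f(x - t)`. -/
noncomputable def translateUnitary {d : ℕ} (t : EuclideanSpace ℝ (Fin d)) (ω : ClosedSubset d) :
    L2 ω ≃ₗᵢ[ℂ] L2 (t +ᵥ ω) where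
  toFun f := ⟨fun x => f ((translateEquiv t ω).symm x),
    memℓp_comp (translateEquiv t ω).symm f.2⟩
  invFun f := ⟨fun x => f (translateEquiv t ω x), memℓp_comp (translateEquiv t ω) f.2⟩
  left_inv f := by
    ext x
    simp
  right_inv f := by
    ext x
    simp
  map_add' f g := rfl
  map_smul' c f := rfl
  norm_map' f := by
    have h : 0 < (2 : ENNReal).toReal := by norm_num
    rw [lp.norm_eq_tsum_rpow h, lp.norm_eq_tsum_rpow h]
    congr 1
    exact (translateEquiv t ω).symm.tsum_eq (fun x => ‖f x‖ ^ (2 : ENNReal).toReal)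

section RandomOperator

variable {d : ℕ} (Ω : SubAddAction (EuclideanSpace ℝ (Fin d)) (ClosedSubset d))

/-- The bundle `𝒳 = {(ω, x) : ω ∈ Ω, x ∈ ω}`, with the topology induced by the product topology
and its Borel σ-algebra. -/
def Bundle : Type := {p : Ω × EuclideanSpace ℝ (Fin d) // p.2 ∈ (p.1 : ClosedSubset d).carrier}

instance : TopologicalSpace (Bundle Ω) := instTopologicalSpaceSubtype

instance : MeasurableSpace (Bundle Ω) := borel _

variable {Ω}

/-- The measurable sections: `f` is measurable as a function on `𝒳`, with `f(ω, ·) ∈ ℓ²(ω)` for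
every `ω`. -/
def IsMeasurableSection (f : ∀ ω : Ω, L2 (ω : ClosedSubset d)) : Prop :=
  Measurable fun p : Bundle Ω => f p.1.1 ⟨p.1.2, p.2⟩

/-- Covariant, measurable and bounded families of operators (the representatives of the elements
of the von Neumann algebra of random operators). -/
structure IsRandomOperator
    (A : ∀ ω : Ω, L2 (ω : ClosedSubset d) →L[ℂ] L2 (ω : ClosedSubset d)) : Prop where
  covariant : ∀ (t : EuclideanSpace ℝ (Fin d)) (ω : Ω) (f : L2 (ω : ClosedSubset d)),
    A (t +ᵥ ω) (translateUnitary t (ω : ClosedSubset d) f)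
      = translateUnitary t (ω : ClosedSubset d) (A ω f)
  measurable : ∀ f g : ∀ ω : Ω, L2 (ω : ClosedSubset d),
    IsMeasurableSection f → IsMeasurableSection g →
      Measurable fun ω => inner ℂ (f ω) (A ω (g ω))
  bounded : ∃ C : ℝ, ∀ ω, ‖A ω‖ ≤ C

end RandomOperator

end DeloneOp

/-! Every spectral type is encoded in countably many events. For a selfadjoint `T` and a subspace
`p` invariant under all `f(T)`, a real `x` lies in the spectrum of `T` on `p` exactly when `φ(T)` is
nonzero on `p` for every rational tent function `φ` with `φ(x) ≠ 0` (`spectrum_restrict_eq`;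
`spectrum_eq` for the full spectrum). So the spectra of `A_ω` are determined by the truth values of
"`φ(A_ω)` is nonzero on `H_•`". Covariance makes these events translation invariant, and ergodicity
makes them constant off a single null set (`exists_ae_iff_of_invariant`), provided that they are
measurable.

Measurability is the main work. A cube of side `r/d` contains at most one point of `ω`, so the
indicators of the cells of a fixed lattice restrict to a Parseval frame of `ℓ²(ω)`: the delta basis
padded with zeros, indexed by `ℤ^d` for all `ω` at once. Polynomial approximation makes the frame
matrix of `f(A_ω)` measurable in `ω`, so the spectral measures of each frame vector form a finite
kernel. Its absolutely continuous, singular continuous and atomic parts can be cut out by jointly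
measurable sets, and these parts alone decide whether `f(T)` vanishes on `H_•`
(`exists_cfc_ne_zero_iff`).

A point of the discrete spectrum would give a tent function `φ` for which `φ(A_ω)` has finite
nonzero trace (`exists_tent_of_mem_discSpectrum`). The trace is a sum over cells which lattice
translations permute transitively, so by invariance of `μ` it is almost surely zero or infinite
(`ae_tsum_eq_top_or`). Hence the discrete spectrum is almost surely empty, and the essential
spectrum is the whole spectrum. -/

namespace DeloneOp

/-! ### Spectral measures and the continuous functional calculus -/

section SpectralTheory

variable {H : Type*} [NormedAddCommGroup H] [InnerProductSpace ℂ H] [CompleteSpace H]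

/-- A continuous cutoff function that equals one on the spectrum. -/
theorem exists_cutoff (T : H →L[ℂ] H) :
    ∃ χ : C_c(ℝ, ℝ), (∀ x, 0 ≤ χ x) ∧ ∀ x ∈ spectrum ℝ T, χ x = 1 := by
  have hc : IsCompact (spectrum ℝ T) :=
    ContinuousFunctionalCalculus.isCompact_spectrum (R := ℝ) T
  obtain ⟨f, hf, -, hfc, h01⟩ := exists_continuous_one_zero_of_isCompact hc
    isClosed_empty (Set.disjoint_empty _)
  exact ⟨⟨f, hfc⟩, fun x => (h01 x).1, fun x hx => hf hx⟩

/-- The product of a continuous function and a compactly supported one. -/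
def mulCc {f : ℝ → ℝ} (hf : Continuous f) (χ : C_c(ℝ, ℝ)) : C_c(ℝ, ℝ) where
  toFun x := f x * χ x
  continuous_toFun := hf.mul χ.continuous
  hasCompactSupport' := χ.hasCompactSupport.mul_left

theorem cfc_mulCc (T : H →L[ℂ] H) {χ : C_c(ℝ, ℝ)} (hχ : ∀ x ∈ spectrum ℝ T, χ x = 1)
    {f : ℝ → ℝ} (hf : Continuous f) : cfc (mulCc hf χ : ℝ → ℝ) T = cfc f T :=
  cfc_congr fun x hx => by
    change f x * χ x = f x
    rw [hχ x hx, mul_one]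

/-- Multiplying `μ_v` by the density `χ` does not change it, because `fχ = f` on the spectrum and so
`(fχ)(T) = f(T)` for every test function `f`. This localisation extends the integral formula from
`C_c(ℝ)` to all continuous functions and makes `μ_v` finite. -/
theorem ae_cutoff_eq_one {T : H →L[ℂ] H} {χ : C_c(ℝ, ℝ)} (hχ0 : ∀ x, 0 ≤ χ x)
    (hχ : ∀ x ∈ spectrum ℝ T, χ x = 1) (v : H) :
    ∀ᵐ x ∂(spectralMeasure T v), χ x = 1 := by
  have : IsLocallyFiniteMeasure
      ((spectralMeasure T v).withDensity (fun x => ENNReal.ofReal (χ x))) :=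
    IsLocallyFiniteMeasure.withDensity_ofReal χ.continuous
  have hm : Measurable fun x => ENNReal.ofReal (χ x) :=
    ENNReal.measurable_ofReal.comp χ.continuous.measurable
  have h : (spectralMeasure T v).withDensity (fun x => ENNReal.ofReal (χ x))
      = (spectralMeasure T v).withDensity 1 := by
    rw [withDensity_one]
    refine Measure.ext_of_integral_eq_on_compactlySupported fun f => ?_
    rw [integral_withDensity_eq_integral_toReal_smul hm (by simp)]
    have hg : ∀ x : ℝ, (ENNReal.ofReal (χ x)).toReal • f x = mulCc f.continuous χ x := fun x => by
      rw [ENNReal.toReal_ofReal (hχ0 x), smul_eq_mul, mul_comm]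
      rfl
    simp_rw [hg]
    rw [integral_spectralMeasure, integral_spectralMeasure, cfc_mulCc T hχ]
    rfl
  replace h := (withDensity_eq_iff_of_sigmaFinite hm.aemeasurable measurable_one.aemeasurable).1 h
  filter_upwards [h] with x hx
  simpa using hx

theorem ae_eq_mulCc {T : H →L[ℂ] H} {χ : C_c(ℝ, ℝ)} (hχ0 : ∀ x, 0 ≤ χ x)
    (hχ : ∀ x ∈ spectrum ℝ T, χ x = 1) (v : H) {f : ℝ → ℝ} (hf : Continuous f) :
    f =ᵐ[spectralMeasure T v] mulCc hf χ := by
  filter_upwards [ae_cutoff_eq_one hχ0 hχ v] with x hx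
  change f x = f x * χ x
  rw [hx, mul_one]

theorem integrable_spectralMeasure (T : H →L[ℂ] H) (v : H) {f : ℝ → ℝ} (hf : Continuous f) :
    Integrable f (spectralMeasure T v) := by
  obtain ⟨χ, h0, h1⟩ := exists_cutoff T
  exact (mulCc hf χ).integrable.congr (ae_eq_mulCc h0 h1 v hf).symm

theorem integral_spectralMeasure_of_continuous (T : H →L[ℂ] H) (v : H) {f : ℝ → ℝ}
    (hf : Continuous f) :
    ∫ x, f x ∂(spectralMeasure T v) = (inner ℂ v (cfc f T v)).re := by
  obtain ⟨χ, h0, h1⟩ := exists_cutoff T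
  rw [integral_congr_ae (ae_eq_mulCc h0 h1 v hf), integral_spectralMeasure, cfc_mulCc T h1]

instance isFiniteMeasure_spectralMeasure (T : H →L[ℂ] H) (v : H) :
    IsFiniteMeasure (spectralMeasure T v) := by
  have h := integrable_spectralMeasure T v (f := fun _ => 1) continuous_const
  rcases integrable_const_iff.1 h with h | h
  · simp at h
  · exact h

theorem spectralMeasure_univ {T : H →L[ℂ] H} (hT : IsSelfAdjoint T) (v : H) :
    spectralMeasure T v Set.univ = ENNReal.ofReal (‖v‖ ^ 2) := by
  have h := integral_spectralMeasure_of_continuous T v (f := fun _ => 1) continuous_const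
  rw [cfc_const_one ℝ T] at h
  simp only [integral_const, smul_eq_mul, mul_one, one_apply_eq_self,
    inner_self_eq_norm_sq_to_K] at h
  rw [← ENNReal.ofReal_toReal (measure_ne_top (spectralMeasure T v) Set.univ)]
  congr 1
  rw [Measure.real] at h
  rw [h]
  norm_cast

theorem inner_cfc_left (T : H →L[ℂ] H) (f : ℝ → ℝ) (u v : H) :
    inner ℂ (cfc f T u) v = inner ℂ u (cfc f T v) := by
  have h : IsSelfAdjoint (cfc f T) := cfc_predicate f T
  exact h.isSymmetric u v

/-- This is `⟨f(T)v, g(T)f(T)v⟩ = ⟨v, (fgf)(T)v⟩`. Its total mass gives the isometry `‖f(T)v‖ = ‖f‖`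
in `L²(μ_v)`, which does the work of the spectral theorem from here on. -/
theorem spectralMeasure_cfc (T : H →L[ℂ] H) {f : ℝ → ℝ}
    (hf : Continuous f) (v : H) :
    spectralMeasure T (cfc f T v)
      = (spectralMeasure T v).withDensity (fun x => ENNReal.ofReal (f x ^ 2)) := by
  have : IsLocallyFiniteMeasure
      ((spectralMeasure T v).withDensity (fun x => ENNReal.ofReal (f x ^ 2))) :=
    IsLocallyFiniteMeasure.withDensity_ofReal (by fun_prop)
  refine Measure.ext_of_integral_eq_on_compactlySupported fun g => ?_
  rw [integral_withDensity_eq_integral_toReal_smul (by fun_prop) (by simp)]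
  have hg : ∀ x : ℝ, (ENNReal.ofReal (f x ^ 2)).toReal • g x = f x * (g x * f x) := fun x => by
    rw [ENNReal.toReal_ofReal (sq_nonneg _), smul_eq_mul]
    ring
  simp_rw [hg]
  rw [integral_spectralMeasure, integral_spectralMeasure_of_continuous T v (by fun_prop),
    cfc_mul f (fun x => g x * f x) T (by fun_prop) (by fun_prop),
    cfc_mul g f T (by fun_prop) (by fun_prop), inner_cfc_left]
  rfl

theorem norm_sq_cfc {T : H →L[ℂ] H} (hT : IsSelfAdjoint T) {f : ℝ → ℝ}
    (hf : Continuous f) (v : H) :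
    ENNReal.ofReal (‖cfc f T v‖ ^ 2)
      = ∫⁻ x, ENNReal.ofReal (f x ^ 2) ∂(spectralMeasure T v) := by
  rw [← spectralMeasure_univ hT, spectralMeasure_cfc T hf, withDensity_apply _ MeasurableSet.univ,
    setLIntegral_univ]

theorem cfc_apply_eq_zero_iff {T : H →L[ℂ] H} (hT : IsSelfAdjoint T) {f : ℝ → ℝ}
    (hf : Continuous f) (v : H) :
    cfc f T v = 0 ↔ spectralMeasure T v {x | f x ≠ 0} = 0 := by
  have h := norm_sq_cfc hT hf v
  have h1 : cfc f T v = 0 ↔ ENNReal.ofReal (‖cfc f T v‖ ^ 2) = 0 := by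
    rw [ENNReal.ofReal_eq_zero]
    constructor
    · intro h; simp [h]
    · intro h
      have := le_antisymm h (sq_nonneg _)
      simpa using this
  rw [h1, h, lintegral_eq_zero_iff (by fun_prop), Filter.EventuallyEq, ae_iff]
  congr! 4 with x
  simp only [Pi.zero_apply, ENNReal.ofReal_eq_zero]
  rw [(sq_nonneg (f x)).ge_iff_eq']
  simp

/-- Parallelogram law for `v ↦ μ_v`, with `μ_{u-v}` dropped. Unlike the absolute continuity of
`μ_{u+v}`, this bound survives limits of vectors. -/
theorem spectralMeasure_add_le (T : H →L[ℂ] H) (u v : H) (C : Set ℝ) :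
    spectralMeasure T (u + v) C ≤ 2 * (spectralMeasure T u C + spectralMeasure T v C) := by
  have h : spectralMeasure T (u + v) + spectralMeasure T (u - v)
      = (2 : NNReal) • (spectralMeasure T u + spectralMeasure T v) := by
    refine Measure.ext_of_integral_eq_on_compactlySupported fun f => ?_
    rw [integral_add_measure f.integrable f.integrable, integral_smul_nnreal_measure,
      integral_add_measure f.integrable f.integrable]
    simp only [integral_spectralMeasure, map_add, map_sub, inner_add_left, inner_add_right,
      inner_sub_left, inner_sub_right, Complex.add_re, Complex.sub_re, NNReal.smul_def]
    simp only [NNReal.coe_ofNat, smul_eq_mul]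
    ring
  have h2 := congrArg (fun m : Measure ℝ => m C) h
  simp only [Measure.add_apply, Measure.smul_apply] at h2
  calc _ ≤ _ := le_self_add
    _ = _ := h2
    _ = _ := rfl

/-- The vectors whose spectral measure does not charge `C` are a closed subspace. -/
theorem spectralMeasure_eq_zero_of_total {T : H →L[ℂ] H} (hT : IsSelfAdjoint T) {ι : Type*}
    {e : ι → H} (he : ∀ v, (∀ k, inner ℂ (e k) v = 0) → v = 0) {C : Set ℝ}
    (hC : ∀ k, spectralMeasure T (e k) C = 0) (v : H) : spectralMeasure T v C = 0 := by
  let K : Submodule ℂ H := spectralSubspace T (fun ν => ν C = 0) (by simp)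
    (fun ν₁ ν₂ h₁ h₂ => by simp [h₁, h₂]) (fun ν₁ ν₂ h h₂ => h h₂)
  have hK : K.topologicalClosure = ⊤ := by
    rw [Submodule.topologicalClosure_eq_top_iff, Submodule.eq_bot_iff]
    intro w hw
    refine he w fun k => ?_
    exact (Submodule.mem_orthogonal K w).1 hw (e k) (hC k)
  have hv : v ∈ closure (K : Set H) := by
    have : v ∈ K.topologicalClosure := hK ▸ Submodule.mem_top
    exact this
  obtain ⟨w, hw, hlim⟩ := mem_closure_iff_seq_limit.1 hv
  have hle : ∀ n, spectralMeasure T v C ≤ 2 * ENNReal.ofReal (‖v - w n‖ ^ 2) := fun n => by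
    have h := spectralMeasure_add_le T (v - w n) (w n) C
    rw [sub_add_cancel, show spectralMeasure T (w n) C = 0 from hw n, add_zero] at h
    refine h.trans ?_
    gcongr
    rw [← spectralMeasure_univ hT]
    exact measure_mono (Set.subset_univ _)
  have hlim2 : Tendsto (fun n => 2 * ENNReal.ofReal (‖v - w n‖ ^ 2)) atTop (𝓝 (2 * 0)) := by
    refine ENNReal.Tendsto.const_mul ?_ (Or.inr (by simp))
    rw [← ENNReal.ofReal_zero]
    refine ENNReal.tendsto_ofReal ?_
    have : Tendsto (fun n => ‖v - w n‖ ^ 2) atTop (𝓝 (‖v - v‖ ^ 2)) :=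
      ((tendsto_const_nhds.sub hlim).norm).pow 2
    simpa using this
  rw [mul_zero] at hlim2
  exact le_antisymm (ge_of_tendsto' hlim2 hle) bot_le

theorem cfc_unitary {H' : Type*} [NormedAddCommGroup H'] [InnerProductSpace ℂ H']
    [CompleteSpace H'] (U : H ≃ₗᵢ[ℂ] H') {T : H →L[ℂ] H} {T' : H' →L[ℂ] H'}
    (hT : IsSelfAdjoint T) (h : ∀ v, T' (U v) = U (T v)) {f : ℝ → ℝ} (hf : Continuous f) (v : H) :
    cfc f T' (U v) = U (cfc f T v) := by
  have hT' : T' = U.conjStarAlgEquiv T := by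
    ext w
    rw [LinearIsometryEquiv.conjStarAlgEquiv_apply_apply, ← h, U.apply_symm_apply]
  have hc : Continuous (U.conjStarAlgEquiv : (H →L[ℂ] H) → (H' →L[ℂ] H')) := by
    have : (U.conjStarAlgEquiv : (H →L[ℂ] H) → (H' →L[ℂ] H')) = fun x =>
      (U.toContinuousLinearEquiv : H →L[ℂ] H') ∘L x ∘L
        (U.symm.toContinuousLinearEquiv : H' →L[ℂ] H) := rfl
    rw [this]
    fun_prop
  have h1 := StarAlgHomClass.map_cfc (S := ℂ) U.conjStarAlgEquiv f T hf.continuousOn hc hT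
    (hT.map U.conjStarAlgEquiv)
  rw [hT', ← h1, LinearIsometryEquiv.conjStarAlgEquiv_apply_apply, U.symm_apply_apply]

theorem spectralMeasure_unitary {H' : Type*} [NormedAddCommGroup H'] [InnerProductSpace ℂ H']
    [CompleteSpace H'] (U : H ≃ₗᵢ[ℂ] H') {T : H →L[ℂ] H} {T' : H' →L[ℂ] H'}
    (hT : IsSelfAdjoint T) (h : ∀ v, T' (U v) = U (T v)) (v : H) :
    spectralMeasure T' (U v) = spectralMeasure T v := by
  refine Measure.ext_of_integral_eq_on_compactlySupported fun f => ?_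
  rw [integral_spectralMeasure, integral_spectralMeasure, cfc_unitary U hT h (map_continuous f),
    U.inner_map_map]

theorem enorm_cfc {T : H →L[ℂ] H} (hT : IsSelfAdjoint T) {f : ℝ → ℝ} (hf : Continuous f) (v : H) :
    ‖cfc f T v‖ₑ = eLpNorm f 2 (spectralMeasure T v) := by
  have h := norm_sq_cfc hT hf v
  have h2 : ∀ x, ENNReal.ofReal (f x ^ 2) = ‖f x‖ₑ ^ 2 := fun x => by
    rw [Real.enorm_eq_ofReal_abs, ← ENNReal.ofReal_pow (abs_nonneg _), sq_abs]
  simp_rw [h2] at h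
  rw [ENNReal.ofReal_pow (norm_nonneg _), ofReal_norm] at h
  rw [eLpNorm_eq_lintegral_rpow_enorm_toReal (by simp) (by simp)]
  simp only [ENNReal.toReal_ofNat, ENNReal.rpow_ofNat]
  rw [← h, ← ENNReal.rpow_natCast, ← ENNReal.rpow_mul]
  simp

/-- The vector `w` plays the role of `1_B(T) v`. -/
theorem exists_spectral_cut {T : H →L[ℂ] H} (hT : IsSelfAdjoint T) (v : H) {B : Set ℝ}
    (hB : MeasurableSet B) :
    ∃ w, spectralMeasure T w Bᶜ = 0 ∧ spectralMeasure T (v - w) B = 0 := by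
  -- In place of a Borel functional calculus, the indicator of `B` is approximated in `L²(μ_v)` by
  -- continuous `g n`; the isometry makes `g n (T) v` a Cauchy sequence, and `w` is its limit.
  have hmem : MemLp (B.indicator fun _ => (1 : ℝ)) 2 (spectralMeasure T v) :=
    memLp_indicator_const 2 hB 1 (Or.inr (measure_ne_top _ _))
  have hex : ∀ n : ℕ, ∃ g : ℝ → ℝ, Continuous g ∧
      eLpNorm (B.indicator (fun _ => (1 : ℝ)) - g) 2 (spectralMeasure T v) ≤ 1 / 2 ^ n := fun n => by
    obtain ⟨g, -, h1, h2, -⟩ := hmem.exists_hasCompactSupport_eLpNorm_sub_le (by simp)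
      (ε := 1 / 2 ^ n) (by simp)
    exact ⟨g, h2, h1⟩
  choose g hg hgB using hex
  have hBm : AEStronglyMeasurable (B.indicator fun _ => (1 : ℝ)) (spectralMeasure T v) := hmem.1
  have hcau : CauchySeq fun n => cfc (g n) T v := by
    refine cauchySeq_of_edist_le_geometric_two 2 (by simp) fun n => ?_
    have h1 : cfc (g n) T v - cfc (g (n + 1)) T v = cfc (fun x => g n x - g (n + 1) x) T v := by
      rw [cfc_sub (a := T) (g n) (g (n + 1)) (hg n).continuousOn (hg _).continuousOn]
      rfl
    rw [edist_eq_enorm_sub, h1, enorm_cfc hT (f := fun x => g n x - g (n + 1) x) ((hg n).sub (hg (n + 1)))]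
    have h2 : (fun x => g n x - g (n + 1) x)
        = (B.indicator (fun _ => (1 : ℝ)) - g (n + 1)) - (B.indicator (fun _ => (1 : ℝ)) - g n) := by
      ext x
      simp
    rw [h2]
    refine (eLpNorm_sub_le (hBm.sub (hg _).aestronglyMeasurable)
      (hBm.sub (hg _).aestronglyMeasurable) (by norm_num)).trans ?_
    have h3 : (1 : ENNReal) / 2 ^ (n + 1) ≤ 1 / 2 ^ n := by
      gcongr <;> simp
    calc _ ≤ 1 / 2 ^ n + 1 / 2 ^ n := add_le_add ((hgB _).trans h3) (hgB n)
      _ = 2 / 2 ^ n := by rw [← ENNReal.add_div]; norm_num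
  obtain ⟨w, hw⟩ := cauchySeq_tendsto_of_complete hcau
  have hlim : Tendsto (fun n => 2 * (ENNReal.ofReal (‖w - cfc (g n) T v‖ ^ 2)
      + (1 / 2 ^ n) ^ 2)) atTop (𝓝 0) := by
    have h1 : Tendsto (fun n => ENNReal.ofReal (‖w - cfc (g n) T v‖ ^ 2)) atTop (𝓝 0) := by
      rw [← ENNReal.ofReal_zero]
      refine ENNReal.tendsto_ofReal ?_
      have : Tendsto (fun n => ‖w - cfc (g n) T v‖ ^ 2) atTop (𝓝 (‖w - w‖ ^ 2)) :=
        ((tendsto_const_nhds.sub hw).norm).pow 2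
      simpa using this
    have h2 : Tendsto (fun n : ℕ => ((1 : ENNReal) / 2 ^ n) ^ 2) atTop (𝓝 0) := by
      have h3 : Tendsto (fun n : ℕ => ((2 : ENNReal)⁻¹) ^ n) atTop (𝓝 0) :=
        ENNReal.tendsto_pow_atTop_nhds_zero_of_lt_one (by simp)
      have h4 := ENNReal.Tendsto.pow (n := 2) h3
      simpa [ENNReal.inv_pow] using h4
    have h5 := ENNReal.Tendsto.const_mul (a := 2) (h1.add h2) (Or.inr (by simp))
    simpa using h5
  have hD : ∀ n, ∫⁻ x, ‖(B.indicator (fun _ => (1 : ℝ)) - g n) x‖ₑ ^ 2 ∂(spectralMeasure T v)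
      ≤ (1 / 2 ^ n) ^ 2 := fun n => by
    have h := hgB n
    rw [eLpNorm_eq_lintegral_rpow_enorm_toReal (by simp) (by simp)] at h
    simp only [ENNReal.toReal_ofNat, ENNReal.rpow_ofNat] at h
    calc _ = ((∫⁻ x, ‖(B.indicator (fun _ => (1 : ℝ)) - g n) x‖ₑ ^ 2
          ∂(spectralMeasure T v)) ^ (1 / 2 : ℝ)) ^ 2 := by
          rw [← ENNReal.rpow_natCast, ← ENNReal.rpow_mul]; simp
      _ ≤ _ := by gcongr
  -- Used twice: with `f = g n` on the complement of `B`, and with `f = 1 - g n` on `B`.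
  have key : ∀ {f : ℝ → ℝ} (_ : Continuous f) {C : Set ℝ} (_ : MeasurableSet C) (n : ℕ),
      (∀ x ∈ C, |f x| = |(B.indicator (fun _ => (1 : ℝ)) - g n) x|) →
      spectralMeasure T (cfc f T v) C ≤ (1 / 2 ^ n) ^ 2 := fun {f} hf {C} hC n hfC => by
    rw [spectralMeasure_cfc T hf, withDensity_apply _ hC]
    refine le_trans ?_ (hD n)
    refine le_trans (le_of_eq ?_) (setLIntegral_le_lintegral C _)
    refine setLIntegral_congr_fun hC fun x hx => ?_
    rw [Real.enorm_eq_ofReal_abs, ← hfC x hx, ← ENNReal.ofReal_pow (abs_nonneg _), sq_abs]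
  refine ⟨w, le_antisymm ?_ bot_le, le_antisymm ?_ bot_le⟩
  · refine ge_of_tendsto' hlim fun n => ?_
    have h := spectralMeasure_add_le T (w - cfc (g n) T v) (cfc (g n) T v) Bᶜ
    rw [sub_add_cancel] at h
    refine h.trans ?_
    gcongr
    · rw [← spectralMeasure_univ hT]
      exact measure_mono (Set.subset_univ _)
    · refine key (hg n) hB.compl n fun x hx => ?_
      simp [Set.indicator_of_notMem hx]
  · refine ge_of_tendsto' hlim fun n => ?_
    have h := spectralMeasure_add_le T (-(w - cfc (g n) T v)) (v - cfc (g n) T v) B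
    rw [show -(w - cfc (g n) T v) + (v - cfc (g n) T v) = v - w by abel] at h
    refine h.trans ?_
    have h1 : v - cfc (g n) T v = cfc (fun x => 1 - g n x) T v := by
      rw [cfc_sub (a := T) (fun _ => 1) (g n) continuousOn_const (hg _).continuousOn,
        cfc_const_one ℝ T]
      rfl
    gcongr
    · rw [← norm_neg (w - _), ← spectralMeasure_univ hT]
      exact measure_mono (Set.subset_univ _)
    · rw [h1]
      refine key (continuous_const.sub (hg n)) hB n fun x hx => ?_
      simp [Set.indicator_of_mem hx]

end SpectralTheory

/-! ### The spectrum on an invariant subspace, detected by tent functions -/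

section RestrictedSpectrum

variable {H : Type*} [NormedAddCommGroup H] [InnerProductSpace ℂ H] [CompleteSpace H]

/-- The tent function with centre `q.1` and radius `q.2`. -/
def tent (q : ℚ × ℚ) (x : ℝ) : ℝ := max 0 (q.2 - |x - q.1|)

theorem continuous_tent (q : ℚ × ℚ) : Continuous (tent q) := by
  unfold tent
  fun_prop

theorem tent_nonneg (q : ℚ × ℚ) (x : ℝ) : 0 ≤ tent q x := le_max_left _ _

theorem tent_ne_zero_iff {q : ℚ × ℚ} {x : ℝ} : tent q x ≠ 0 ↔ |x - q.1| < q.2 := by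
  rw [← (tent_nonneg q x).lt_iff_ne', tent]
  simp

theorem exists_tent (x : ℝ) {ε : ℝ} (hε : 0 < ε) :
    ∃ q : ℚ × ℚ, tent q x ≠ 0 ∧ ∀ y, tent q y ≠ 0 → |y - x| < ε := by
  obtain ⟨b, hb0, hb⟩ := exists_rat_btwn (show (0 : ℝ) < ε / 2 by positivity)
  obtain ⟨a, ha, ha'⟩ := exists_rat_btwn (show x - b < x by linarith)
  refine ⟨(a, b), tent_ne_zero_iff.2 ?_, fun y hy => ?_⟩
  · rw [abs_lt]
    constructor <;> linarith
  · have h := tent_ne_zero_iff.1 hy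
    rw [abs_lt] at h ⊢
    simp only at h
    constructor <;> linarith

/-- The factorisation `|y - z|² = (y - z)(y - conj z)` on the real line lets the real functional
calculus produce resolvents at complex `z`. -/
theorem cfc_shifted_sq {T : H →L[ℂ] H} (hT : IsSelfAdjoint T) (z : ℂ) (v : H) :
    cfc (fun y : ℝ => (y - z.re) ^ 2 + z.im ^ 2) T v
      = T (T v) - z • T v - (starRingEnd ℂ z) • (T v - z • v) := by
  have h1 : cfc (fun y : ℝ => y - z.re) T = T - algebraMap ℝ (H →L[ℂ] H) z.re := by
    rw [cfc_sub (a := T) (fun y : ℝ => y) (fun _ => z.re) (by fun_prop) (by fun_prop),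
      cfc_id' ℝ T, cfc_const z.re T]
  have h2 : cfc (fun y : ℝ => (y - z.re) ^ 2 + z.im ^ 2) T
      = (T - algebraMap ℝ (H →L[ℂ] H) z.re) * (T - algebraMap ℝ (H →L[ℂ] H) z.re)
        + algebraMap ℝ (H →L[ℂ] H) (z.im ^ 2) := by
    rw [cfc_add (a := T) (fun y : ℝ => (y - z.re) ^ 2) (fun _ => z.im ^ 2) (by fun_prop)
      (by fun_prop), cfc_const (z.im ^ 2) T, cfc_pow (fun y : ℝ => y - z.re) 2 T (by fun_prop), h1,
      sq]
  rw [h2]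
  simp only [Algebra.algebraMap_eq_smul_one]
  change T (T v - z.re • v) - z.re • (T v - z.re • v) + (z.im ^ 2) • v = _
  have e1 : ∀ (c : ℝ) (w : H), c • w = (c : ℂ) • w := fun c w => (Complex.coe_smul c w).symm
  rcases z with ⟨a, b⟩
  have e2 : (⟨a, b⟩ : ℂ) = a + b * Complex.I := Complex.mk_eq_add_mul_I a b
  have e3 : starRingEnd ℂ (a + b * Complex.I) = a - b * Complex.I := by
    apply Complex.ext <;> simp
  have e4 : (a + b * Complex.I : ℂ).re = a := by simp
  have e5 : (a + b * Complex.I : ℂ).im = b := by simp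
  rw [e2, e3, e4, e5]
  simp only [e1, map_sub, map_smul]
  match_scalars
  · ring
  · ring
  · linear_combination (b : ℂ) ^ 2 * Complex.I_sq

theorem cfc_mul_apply (T : H →L[ℂ] H) {f g : ℝ → ℝ} (hf : Continuous f) (hg : Continuous g)
    (v : H) : cfc f T (cfc g T v) = cfc (fun x => f x * g x) T v := by
  rw [cfc_mul f g T hf.continuousOn hg.continuousOn]
  rfl

theorem apply_cfc_comm {T : H →L[ℂ] H} (hT : IsSelfAdjoint T) {f : ℝ → ℝ} (hf : Continuous f)
    (v : H) : T (cfc f T v) = cfc f T (T v) := by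
  have h := cfc_mul_apply T continuous_id hf v
  have h' := cfc_mul_apply T hf continuous_id v
  have h3 : cfc (id : ℝ → ℝ) T = T := cfc_id ℝ T
  rw [h3] at h h'
  rw [h, h']
  simp_rw [mul_comm]

/-- If `f(T)` vanishes on the invariant subspace `p` and `f` does not vanish at `z`, then `z` is
not in the spectrum of the restriction of `T` to `p`. -/
theorem notMem_spectrum_restrict {T : H →L[ℂ] H} (hT : IsSelfAdjoint T) {p : Submodule ℂ H}
    (hp : ∀ v ∈ p, T v ∈ p) (hinv : ∀ f : ℝ → ℝ, Continuous f → ∀ v ∈ p, cfc f T v ∈ p)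
    {f : ℝ → ℝ} (hf : Continuous f) (hfp : ∀ v ∈ p, cfc f T v = 0) {z : ℂ}
    (hz : z.im ≠ 0 ∨ f z.re ≠ 0) : z ∉ spectrum ℂ (T.restrict hp) := by
  -- `D(y) = |y - z|² + f(y)²` has no zero. Since `f(T) = 0` on `p`, the operator `(T - z)(T - conj
  -- z) D(T)⁻¹ = 1 - f(T)² D(T)⁻¹` is the identity there. The inverse is thus built from functions
  -- of `T` on `H`, and `p` need not be complete.
  set D : ℝ → ℝ := fun y => (y - z.re) ^ 2 + z.im ^ 2 + f y ^ 2 with hD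
  have hD0 : ∀ y, D y ≠ 0 := fun y h => by
    have h1 : (y - z.re) ^ 2 = 0 := by nlinarith [sq_nonneg (y - z.re), sq_nonneg z.im, sq_nonneg (f y)]
    have h2 : z.im ^ 2 = 0 := by nlinarith [sq_nonneg (y - z.re), sq_nonneg z.im, sq_nonneg (f y)]
    have h3 : f y ^ 2 = 0 := by nlinarith [sq_nonneg (y - z.re), sq_nonneg z.im, sq_nonneg (f y)]
    have h4 : y = z.re := by rw [sq_eq_zero_iff] at h1; linarith
    subst h4
    rcases hz with h | h
    · exact h (sq_eq_zero_iff.1 h2)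
    · exact h (sq_eq_zero_iff.1 h3)
  have hDc : Continuous fun y => (D y)⁻¹ := Continuous.inv₀ (by fun_prop) hD0
  have hW : ∀ v ∈ p, cfc (fun y : ℝ => (y - z.re) ^ 2 + z.im ^ 2) T
      (cfc (fun y => (D y)⁻¹) T v) = v := fun v hv => by
    rw [cfc_mul_apply T (by fun_prop) hDc]
    have h1 : (fun y => ((y - z.re) ^ 2 + z.im ^ 2) * (D y)⁻¹)
        = fun y => 1 - (f y * (D y)⁻¹) * f y := by
      ext y
      have := hD0 y
      field_simp
      simp only [hD]
      ring
    have hfD : Continuous fun y => f y * (D y)⁻¹ := hf.mul hDc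
    rw [h1, cfc_sub (a := T) (fun _ => 1) (fun y => (f y * (D y)⁻¹) * f y) continuousOn_const
      (hfD.mul hf).continuousOn, cfc_const_one ℝ T]
    change v - cfc (fun y => (f y * (D y)⁻¹) * f y) T v = v
    rw [← cfc_mul_apply T hfD hf, hfp v hv, map_zero, sub_zero]
  set S := T.restrict hp with hS
  let W : p →L[ℂ] p := (cfc (fun y => (D y)⁻¹) T).restrict (hinv _ hDc)
  let V : p →L[ℂ] p := (S - algebraMap ℂ _ (starRingEnd ℂ z)) * W
  have hcomm : S * W = W * S := by
    ext v
    exact apply_cfc_comm hT hDc v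
  have h1 : (S - algebraMap ℂ _ z) * V = 1 := by
    ext v
    have h := hW v v.2
    rw [cfc_shifted_sq hT] at h
    simp only [V, Algebra.algebraMap_eq_smul_one]
    set w : H := cfc (fun y => (D y)⁻¹) T v with hw
    change T (T w - (starRingEnd ℂ z) • w) - z • (T w - (starRingEnd ℂ z) • w) = v
    refine Eq.trans ?_ h
    simp only [map_sub, map_smul]
    module
  have hVS : V * (S - algebraMap ℂ _ z) = (S - algebraMap ℂ _ z) * V := by
    have c1 : Commute S W := hcomm
    have c2 : Commute (S - algebraMap ℂ _ z) W :=
      c1.sub_left (Algebra.commutes z W)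
    have c3 : Commute (S - algebraMap ℂ _ z) (S - algebraMap ℂ _ (starRingEnd ℂ z)) :=
      ((Commute.refl S).sub_right (Algebra.commute_algebraMap_right _ S)).sub_left (Algebra.commutes z _)
    exact (c3.mul_right c2).symm
  rw [spectrum.notMem_iff, ← IsUnit.neg_iff, neg_sub]
  exact ⟨⟨_, V, h1, hVS.trans h1⟩, rfl⟩

/-- A bounded inverse gives `‖v‖ ≤ C ‖(T - x)v‖` on `p`. For a tent supported within `1/(2(C+1))` of
`x`, applying this to `v' = tent(T)v` gives `‖v'‖ ≤ ‖v'‖/2`, so `v' = 0`. The `C+1` covers `C = 0`.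
-/
theorem exists_tent_of_notMem_spectrum_restrict {T : H →L[ℂ] H} (hT : IsSelfAdjoint T)
    {p : Submodule ℂ H} (hp : ∀ v ∈ p, T v ∈ p)
    (hinv : ∀ f : ℝ → ℝ, Continuous f → ∀ v ∈ p, cfc f T v ∈ p) {x : ℝ}
    (hx : (x : ℂ) ∉ spectrum ℂ (T.restrict hp)) :
    ∃ q, tent q x ≠ 0 ∧ ∀ v ∈ p, cfc (tent q) T v = 0 := by
  rw [spectrum.notMem_iff] at hx
  obtain ⟨u, hu⟩ := hx
  have hC : ∀ v (hv : v ∈ p), ‖v‖ ≤ ‖(↑u⁻¹ : p →L[ℂ] p)‖ * ‖cfc (fun y : ℝ => y - x) T v‖ :=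
    fun v hv => by
    have h1 : (↑u⁻¹ : p →L[ℂ] p) ((u : p →L[ℂ] p) ⟨v, hv⟩) = ⟨v, hv⟩ := by
      have h2 : (↑u⁻¹ : p →L[ℂ] p) * (u : p →L[ℂ] p) = 1 := u.inv_mul
      exact congrArg (fun a : p →L[ℂ] p => a ⟨v, hv⟩) h2
    have h3 := (↑u⁻¹ : p →L[ℂ] p).le_opNorm ((u : p →L[ℂ] p) ⟨v, hv⟩)
    rw [h1] at h3
    refine h3.trans (le_of_eq ?_)
    congr 1
    rw [hu, cfc_sub (a := T) (fun y : ℝ => y) (fun _ => x) (by fun_prop) (by fun_prop),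
      cfc_id' ℝ T, cfc_const x T, ← norm_neg]
    rw [Algebra.algebraMap_eq_smul_one, Algebra.algebraMap_eq_smul_one]
    change ‖(-((x : ℂ) • v - T v) : H)‖ = ‖T v - x • v‖
    rw [neg_sub, Complex.coe_smul]
  set C := ‖(↑u⁻¹ : p →L[ℂ] p)‖ with hCdef
  have hC0 : 0 ≤ C := norm_nonneg (↑u⁻¹ : p →L[ℂ] p)
  obtain ⟨q, hq, hq'⟩ := exists_tent x (show 0 < 1 / (2 * (C + 1)) by positivity)
  refine ⟨q, hq, fun v hv => ?_⟩
  have h1 := hC _ (hinv _ (continuous_tent q) v hv)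
  rw [cfc_mul_apply T (by fun_prop) (continuous_tent q)] at h1
  have h2 : ‖cfc (fun y => (y - x) * tent q y) T v‖ₑ
      ≤ ENNReal.ofReal (1 / (2 * (C + 1))) * ‖cfc (tent q) T v‖ₑ := by
    have hc : Continuous fun y => (y - x) * tent q y :=
      (by fun_prop : Continuous fun y : ℝ => y - x).mul (continuous_tent q)
    rw [enorm_cfc hT hc, enorm_cfc hT (continuous_tent q)]
    refine eLpNorm_le_mul_eLpNorm_of_ae_le_mul (ae_of_all _ fun y => ?_) 2
    rw [norm_mul]
    by_cases hy : tent q y = 0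
    · simp [hy]
    · gcongr
      exact (hq' y hy).le
  have h3 : ‖cfc (fun y => (y - x) * tent q y) T v‖ ≤ 1 / (2 * (C + 1)) * ‖cfc (tent q) T v‖ := by
    rw [← ofReal_norm, ← ofReal_norm, ← ENNReal.ofReal_mul (by positivity)] at h2
    exact (ENNReal.ofReal_le_ofReal_iff (by positivity)).1 h2
  have h4 : C * (1 / (2 * (C + 1))) ≤ 1 / 2 := by
    rw [mul_one_div, div_le_div_iff₀ (by positivity) (by positivity)]
    linarith
  have h5 : ‖cfc (tent q) T v‖ ≤ 1 / 2 * ‖cfc (tent q) T v‖ :=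
    calc _ ≤ _ := h1
      _ ≤ C * (1 / (2 * (C + 1)) * ‖cfc (tent q) T v‖) := by gcongr
      _ = C * (1 / (2 * (C + 1))) * ‖cfc (tent q) T v‖ := by ring
      _ ≤ _ := by gcongr
  have h6 := norm_nonneg (cfc (tent q) T v)
  exact norm_eq_zero.1 (by linarith)

/-- The spectrum of the restriction to an invariant subspace, through tent functions of `T`. -/
theorem spectrum_restrict_eq {T : H →L[ℂ] H} (hT : IsSelfAdjoint T) {p : Submodule ℂ H}
    (hp : ∀ v ∈ p, T v ∈ p) (hinv : ∀ f : ℝ → ℝ, Continuous f → ∀ v ∈ p, cfc f T v ∈ p) :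
    spectrum ℂ (T.restrict hp)
      = Complex.ofReal '' {x | ∀ q, tent q x ≠ 0 → ∃ v ∈ p, cfc (tent q) T v ≠ 0} := by
  ext z
  constructor
  · intro hz
    have him : z.im = 0 := by
      by_contra h
      exact notMem_spectrum_restrict hT hp hinv (f := fun _ => 0) continuous_const
        (fun v _ => by rw [cfc_const_zero ℝ T]; rfl) (Or.inl h) hz
    refine ⟨z.re, fun q hq => ?_, Complex.ext rfl (by simp [him])⟩
    by_contra! h
    exact notMem_spectrum_restrict hT hp hinv (continuous_tent q) h (Or.inr hq) hz
  · rintro ⟨x, hx, rfl⟩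
    by_contra h
    obtain ⟨q, hq, hq'⟩ := exists_tent_of_notMem_spectrum_restrict hT hp hinv h
    obtain ⟨v, hv, hv'⟩ := hx q hq
    exact hv' (hq' v hv)

theorem spectrum_eq {T : H →L[ℂ] H} (hT : IsSelfAdjoint T) :
    spectrum ℂ T = Complex.ofReal '' {x | ∀ q, tent q x ≠ 0 → ∃ v, cfc (tent q) T v ≠ 0} := by
  have h1 : spectrum ℂ T = Complex.ofReal '' spectrum ℝ T :=
    (hT.spectrumRestricts.algebraMap_image).symm
  rw [h1]
  congr 1
  ext x
  constructor
  · intro hx q hq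
    by_contra! h
    have h2 : cfc (tent q) T = 0 := by
      ext v
      exact h v
    have h3 : tent q x ∈ spectrum ℝ (cfc (tent q) T) := by
      rw [cfc_map_spectrum (tent q) T hT (continuous_tent q).continuousOn]
      exact ⟨x, hx, rfl⟩
    rw [h2] at h3
    have : Nontrivial (H →L[ℂ] H) := by
      by_contra hn
      rw [not_nontrivial_iff_subsingleton] at hn
      rw [spectrum.of_subsingleton] at h3
      exact h3
    rw [spectrum.zero_eq] at h3
    exact hq h3
  · intro hx
    by_contra h
    have ho : IsOpen (spectrum ℝ T)ᶜ :=
      (ContinuousFunctionalCalculus.isCompact_spectrum (R := ℝ) T).isClosed.isOpen_compl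
    obtain ⟨ε, hε, hball⟩ := Metric.isOpen_iff.1 ho x h
    obtain ⟨q, hq, hq'⟩ := exists_tent x hε
    obtain ⟨v, hv⟩ := hx q hq
    refine hv ?_
    have h2 : cfc (tent q) T = cfc (fun _ : ℝ => (0 : ℝ)) T := cfc_congr fun y hy => by
      by_contra hy'
      exact hball (by rw [Metric.mem_ball, Real.dist_eq]; exact hq' y hy') hy
    rw [h2, cfc_const_zero ℝ T]
    rfl

end RestrictedSpectrum

/-! ### Splitting spectral measures into spectral types -/

section SpectralDichotomy

variable {H : Type*} [NormedAddCommGroup H] [InnerProductSpace ℂ H] [CompleteSpace H]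

theorem cfc_mem_spectralSubspace (T : H →L[ℂ] H) {P : Measure ℝ → Prop} (h0 : P 0)
    (hadd : ∀ ν₁ ν₂, P ν₁ → P ν₂ → P (ν₁ + ν₂)) (hac : ∀ ν₁ ν₂, ν₁ ≪ ν₂ → P ν₂ → P ν₁)
    (f : ℝ → ℝ) (hf : Continuous f) (v : H) (hv : v ∈ spectralSubspace T P h0 hadd hac) :
    cfc f T v ∈ spectralSubspace T P h0 hadd hac := by
  change P _
  rw [spectralMeasure_cfc T hf]
  exact hac _ _ (withDensity_absolutelyContinuous _ _) hv

theorem measurableSet_ne_zero {f : ℝ → ℝ} (hf : Continuous f) : MeasurableSet {x | f x ≠ 0} :=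
  (isOpen_ne_fun hf continuous_const).measurableSet

/-- If the spectral measures of a total family split into a part in the class `P` and a part
singular to all of `P`, then the former parts decide whether `f(T)` vanishes on the subspace of
`P`. -/
theorem exists_cfc_ne_zero_iff {T : H →L[ℂ] H} (hT : IsSelfAdjoint T) {P : Measure ℝ → Prop}
    (hac : ∀ ν₁ ν₂, ν₁ ≪ ν₂ → P ν₂ → P ν₁) {ι : Type*} [Countable ι]
    {e : ι → H} (he : ∀ v, (∀ k, inner ℂ (e k) v = 0) → v = 0) {B : ι → Set ℝ}
    (hB : ∀ k, MeasurableSet (B k)) (hP : ∀ k, P ((spectralMeasure T (e k)).restrict (B k)))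
    (hPc : ∀ k ν, P ν → (spectralMeasure T (e k)).restrict (B k)ᶜ ⟂ₘ ν)
    {f : ℝ → ℝ} (hf : Continuous f) :
    (∃ v, P (spectralMeasure T v) ∧ cfc f T v ≠ 0) ↔
      ∃ k, spectralMeasure T (e k) ({x | f x ≠ 0} ∩ B k) ≠ 0 := by
  constructor
  · rintro ⟨v, hv, hfv⟩
    by_contra! h
    refine hfv ((cfc_apply_eq_zero_iff hT hf v).2 ?_)
    -- The set `N k` carries `μ_v` and is null for the part of `μ_{e k}` outside `B k`. So every
    -- `μ_{e k}` vanishes on `{f ≠ 0} ∩ ⋂ N k`, hence by totality so does `μ_v`, which is carried by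
    -- `⋂ N k`.
    have hms := fun k => hPc k _ hv
    set N : ι → Set ℝ := fun k => (hms k).nullSet with hN
    have hC : spectralMeasure T v ({x | f x ≠ 0} ∩ ⋂ k, N k) = 0 := by
      refine spectralMeasure_eq_zero_of_total hT he (fun k => ?_) v
      have hsub : {x | f x ≠ 0} ∩ ⋂ k, N k
          ⊆ ({x | f x ≠ 0} ∩ B k) ∪ (N k ∩ (B k)ᶜ) := fun x hx => by
        by_cases hxB : x ∈ B k
        · exact Or.inl ⟨hx.1, hxB⟩
        · exact Or.inr ⟨Set.mem_iInter.1 hx.2 k, hxB⟩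
      refine measure_mono_null hsub (measure_union_null (h k) ?_)
      have h1 := (hms k).measure_nullSet
      rwa [Measure.restrict_apply (hms k).measurableSet_nullSet] at h1
    have hsub : {x | f x ≠ 0} ⊆ ({x | f x ≠ 0} ∩ ⋂ k, N k) ∪ ⋃ k, (N k)ᶜ := fun x hx => by
      by_cases h : x ∈ ⋂ k, N k
      · exact Or.inl ⟨hx, h⟩
      · rw [← Set.compl_iInter]
        exact Or.inr h
    exact measure_mono_null hsub (measure_union_null hC
      (measure_iUnion_null fun k => (hms k).measure_compl_nullSet))
  · rintro ⟨k, hk⟩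
    -- The witness `w` stands for `1_{B k}(T)(e k)`. Comparing `w` with `e k` in both directions
    -- shows that `μ_w` is absolutely continuous with respect to `μ_{e k}` on `B k`, and that `f(T)w
    -- = 0` would make `{f ≠ 0} ∩ B k` null for `μ_{e k}`.
    obtain ⟨w, hw1, hw2⟩ := exists_spectral_cut hT (e k) (hB k)
    refine ⟨w, hac _ _ (fun C hC => ?_) (hP k), fun h => hk ?_⟩
    · have hC' : spectralMeasure T (e k) (C ∩ B k) = 0 :=
        le_antisymm ((Measure.le_restrict_apply _ _).trans hC.le) bot_le
      have h1 := spectralMeasure_add_le T (e k) (-(e k - w)) (C ∩ B k)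
      have h2 : spectralMeasure T (-(e k - w)) (C ∩ B k) = 0 := by
        have h3 := spectralMeasure_smul_ac T (-1) (e k - w)
        rw [neg_one_smul] at h3
        exact measure_mono_null Set.inter_subset_right (h3 hw2)
      rw [hC', h2, add_zero, mul_zero, show e k + -(e k - w) = w by abel] at h1
      have hsub : C ⊆ (C ∩ B k) ∪ (B k)ᶜ := fun x hx => by
        by_cases hxB : x ∈ B k
        · exact Or.inl ⟨hx, hxB⟩
        · exact Or.inr hxB
      exact measure_mono_null hsub (measure_union_null (le_antisymm h1 bot_le) hw1)
    · have h1 := spectralMeasure_add_le T w (e k - w) ({x | f x ≠ 0} ∩ B k)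
      rw [add_sub_cancel, measure_mono_null Set.inter_subset_left
        ((cfc_apply_eq_zero_iff hT hf w).1 h), measure_mono_null Set.inter_subset_right hw2,
        add_zero, mul_zero] at h1
      exact le_antisymm h1 bot_le

/-- The set of atoms of a measure. -/
def atomSet (m : Measure ℝ) : Set ℝ := {x | m {x} ≠ 0}

theorem countable_atomSet (m : Measure ℝ) [IsFiniteMeasure m] : (atomSet m).Countable := by
  have h := Measure.countable_meas_pos_of_disjoint_iUnion (μ := m)
    (As := fun x : ℝ => ({x} : Set ℝ)) (fun x => measurableSet_singleton x)
    (fun x y hxy => Set.disjoint_singleton.2 hxy)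
  refine h.mono fun x hx => ?_
  exact pos_iff_ne_zero.2 hx

theorem restrict_mutuallySingular_of_measure_eq_zero {m ν : Measure ℝ} {S : Set ℝ}
    (hS : MeasurableSet S) (h : ν S = 0) : m.restrict S ⟂ₘ ν :=
  ⟨Sᶜ, hS.compl, by simp [Measure.restrict_apply hS.compl], by rwa [compl_compl]⟩

theorem isPurePoint_restrict_atomSet (m : Measure ℝ) [IsFiniteMeasure m] :
    IsPurePoint (m.restrict (atomSet m)) :=
  ⟨atomSet m, countable_atomSet m, by
    rw [Measure.restrict_apply (countable_atomSet m).measurableSet.compl]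
    simp⟩

theorem measure_compl_atomSet_inter (m : Measure ℝ) {S : Set ℝ} (hS : S.Countable) :
    m (S ∩ (atomSet m)ᶜ) = 0 := by
  have h : S ∩ (atomSet m)ᶜ = ⋃ x ∈ S ∩ (atomSet m)ᶜ, {x} :=
    (Set.biUnion_of_singleton _).symm
  rw [h, measure_biUnion_null_iff (hS.mono Set.inter_subset_left)]
  intro x hx
  by_contra h
  exact hx.2 h

theorem mutuallySingular_of_isPurePoint {m ν : Measure ℝ} (hν : IsPurePoint ν) :
    m.restrict (atomSet m)ᶜ ⟂ₘ ν := by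
  obtain ⟨S, hS, h⟩ := hν
  refine ⟨S, hS.measurableSet, ?_, h⟩
  rw [Measure.restrict_apply hS.measurableSet]
  exact measure_compl_atomSet_inter m hS

theorem isSingCont_restrict {m : Measure ℝ} [IsFiniteMeasure m] {N : Set ℝ}
    (hN : MeasurableSet N) (h : volume N = 0) : IsSingCont (m.restrict (N ∩ (atomSet m)ᶜ)) := by
  have hm := (countable_atomSet m).measurableSet.compl
  refine ⟨fun x => ?_, restrict_mutuallySingular_of_measure_eq_zero (hN.inter hm)
    (measure_mono_null Set.inter_subset_left h)⟩
  rw [Measure.restrict_apply (measurableSet_singleton x)]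
  exact measure_mono_null (Set.inter_subset_inter_right _ Set.inter_subset_right)
    (measure_compl_atomSet_inter m (Set.countable_singleton x))

/-- Outside `N` the measure `m` is absolutely continuous, so singular to `ν`; the countably many
atoms of `m` are `ν`-null because `ν` has none. -/
theorem mutuallySingular_of_isSingCont {m ν : Measure ℝ} [IsFiniteMeasure m] {N : Set ℝ}
    (h : m.restrict Nᶜ ≪ volume) (hν : IsSingCont ν) :
    m.restrict (N ∩ (atomSet m)ᶜ)ᶜ ⟂ₘ ν := by
  rw [Set.compl_inter, compl_compl]
  have h1 : m.restrict Nᶜ ⟂ₘ ν := (hν.2.mono_ac Measure.AbsolutelyContinuous.rfl h).symm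
  have h2 : m.restrict (atomSet m) ⟂ₘ ν :=
    restrict_mutuallySingular_of_measure_eq_zero (countable_atomSet m).measurableSet
      (by
        have h : atomSet m = ⋃ x ∈ atomSet m, {x} := by simp
        rw [h, measure_biUnion_null_iff (countable_atomSet m)]
        exact fun x _ => hν.1 x)
  exact (h1.add_left h2).mono (Measure.restrict_union_le _ _) le_rfl

theorem mutuallySingular_of_absolutelyContinuous {m ν : Measure ℝ} {N : Set ℝ}
    (hN : MeasurableSet N) (h : volume N = 0) (hν : ν ≪ volume) : m.restrict Nᶜᶜ ⟂ₘ ν := by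
  rw [compl_compl]
  exact restrict_mutuallySingular_of_measure_eq_zero hN (hν h)

end SpectralDichotomy

/-! ### Parseval frames -/

section Frame

variable {H : Type*} [NormedAddCommGroup H] [InnerProductSpace ℂ H] {ι : Type*}

/-- A Parseval frame of a Hilbert space. -/
def IsParsevalFrame (e : ι → H) : Prop :=
  ∀ u v, HasSum (fun k => inner ℂ u (e k) * inner ℂ (e k) v) (inner ℂ u v)

theorem IsParsevalFrame.eq_zero {e : ι → H} (he : IsParsevalFrame e) (v : H)
    (h : ∀ k, inner ℂ (e k) v = 0) : v = 0 := by
  have h1 := he v v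
  simp only [h, mul_zero] at h1
  exact inner_self_eq_zero.1 (h1.unique hasSum_zero)

theorem IsParsevalFrame.hasSum_norm_sq {e : ι → H} (he : IsParsevalFrame e) (v : H) :
    HasSum (fun k => ‖inner ℂ (e k) v‖ ^ 2) (‖v‖ ^ 2) := by
  have h1 := he v v
  rw [inner_self_eq_norm_sq_to_K] at h1
  have h2 : ∀ k, inner ℂ v (e k) * inner ℂ (e k) v = ((‖inner ℂ (e k) v‖ ^ 2 : ℝ) : ℂ) := fun k => by
    rw [← inner_conj_symm v (e k), Complex.conj_mul']
    norm_cast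
  simp_rw [h2] at h1
  have h3 : ((RCLike.ofReal ‖v‖ : ℂ)) ^ 2 = ((‖v‖ ^ 2 : ℝ) : ℂ) := by norm_cast
  rw [h3] at h1
  exact Complex.hasSum_ofReal.1 h1

theorem IsParsevalFrame.norm_le_one {e : ι → H} (he : IsParsevalFrame e) (k : ι) : ‖e k‖ ≤ 1 := by
  have h := le_hasSum (he.hasSum_norm_sq (e k)) k fun j _ => sq_nonneg _
  rw [inner_self_eq_norm_sq_to_K] at h
  have h3 : ‖((RCLike.ofReal ‖e k‖ : ℂ)) ^ 2‖ = ‖e k‖ ^ 2 := by simp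
  rw [h3] at h
  by_contra! h1
  have h2 : 1 < ‖e k‖ ^ 2 := by nlinarith
  nlinarith

end Frame

/-! ### Measurability of the functional calculus in the parameter -/

section MeasurableMatrix

variable {X : Type*} [MeasurableSpace X] {H : X → Type*} [∀ x, NormedAddCommGroup (H x)]
  [∀ x, InnerProductSpace ℂ (H x)] {ι : Type*}

/-- The matrix elements of the operator family `A` with respect to `e` are measurable. -/
def MeasurableMatrix (e : ι → ∀ x, H x) (A : ∀ x, H x →L[ℂ] H x) : Prop :=
  ∀ k l, Measurable fun x => inner ℂ (e k x) (A x (e l x))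

variable {e : ι → ∀ x, H x} {A B : ∀ x, H x →L[ℂ] H x}

theorem MeasurableMatrix.add (hA : MeasurableMatrix e A) (hB : MeasurableMatrix e B) :
    MeasurableMatrix e fun x => A x + B x := fun k l => by
  simp only [add_apply, inner_add_right]
  exact (hA k l).add (hB k l)

theorem MeasurableMatrix.const_smul (c : ℝ) (hA : MeasurableMatrix e A) :
    MeasurableMatrix e fun x => c • A x := fun k l => by
  have h : ∀ x, inner ℂ (e k x) ((c • A x) (e l x)) = (c : ℂ) * inner ℂ (e k x) (A x (e l x)) :=
    fun x => by
      change inner ℂ (e k x) (c • A x (e l x)) = _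
      rw [← Complex.coe_smul, inner_smul_right]
  simp_rw [h]
  exact (hA k l).const_mul _

theorem MeasurableMatrix.of_tendsto {F : ℕ → ∀ x, H x →L[ℂ] H x}
    (hF : ∀ n, MeasurableMatrix e (F n)) (h : ∀ x, Tendsto (fun n => F n x) atTop (𝓝 (A x))) :
    MeasurableMatrix e A := fun k l => by
  refine measurable_of_tendsto_metrizable (fun n => hF n k l) ?_
  rw [tendsto_pi_nhds]
  intro x
  have h1 : Tendsto (fun n => F n x (e l x)) atTop (𝓝 (A x (e l x))) :=
    ((ContinuousLinearMap.apply ℂ (H x) (e l x)).continuous.tendsto _).comp (h x)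
  exact tendsto_const_nhds.inner h1

theorem measurable_of_hasSum_complex {κ : Type*} [Countable κ] {f : κ → X → ℂ} {g : X → ℂ}
    (hf : ∀ k, Measurable (f k)) (h : ∀ x, HasSum (fun k => f k x) (g x)) : Measurable g := by
  refine measurable_of_tendsto_metrizable' (u := (atTop : Filter (Finset κ)))
    (f := fun s x => ∑ k ∈ s, f k x) (fun s => Finset.measurable_fun_sum s fun k _ => hf k) ?_
  rw [tendsto_pi_nhds]
  exact h

variable [∀ x, CompleteSpace (H x)]

/-- Parseval expansion of `⟨A* e_k, B e_l⟩` writes the entry as a countable sum of products of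
entries. Frame vectors need not be orthonormal, so the Gram matrix, the matrix of `1`, is a separate
assumption wherever polynomials occur. -/
theorem MeasurableMatrix.mul [Countable ι] (he : ∀ x, IsParsevalFrame fun k => e k x)
    (hA : MeasurableMatrix e A) (hB : MeasurableMatrix e B) :
    MeasurableMatrix e fun x => A x * B x := fun k l => by
  refine measurable_of_hasSum_complex (κ := ι) (fun j => (hA k j).mul (hB j l)) fun x => ?_
  have h := he x (ContinuousLinearMap.adjoint (A x) (e k x)) (B x (e l x))
  simp only [ContinuousLinearMap.adjoint_inner_left] at h
  exact h

theorem MeasurableMatrix.aeval [Countable ι] (he : ∀ x, IsParsevalFrame fun k => e k x)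
    (h1 : MeasurableMatrix e fun x => (1 : H x →L[ℂ] H x)) (hA : MeasurableMatrix e A)
    (p : Polynomial ℝ) : MeasurableMatrix e fun x => Polynomial.aeval (A x) p := by
  induction p using Polynomial.induction_on with
  | C a =>
    simp only [Polynomial.aeval_C, Algebra.algebraMap_eq_smul_one]
    exact h1.const_smul a
  | add p q hp hq =>
    simp only [map_add]
    exact hp.add hq
  | monomial n a h =>
    have h2 : ∀ x, Polynomial.aeval (A x) (Polynomial.C a * Polynomial.X ^ (n + 1))
        = Polynomial.aeval (A x) (Polynomial.C a * Polynomial.X ^ n) * A x := fun x => by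
      simp only [map_mul, map_pow, Polynomial.aeval_X, pow_succ, mul_assoc]
    simp_rw [h2]
    exact h.mul he hA

/-- The uniform norm bound puts all spectra in `[-C, C]`, so one sequence of polynomials
approximates `f` for every `x` simultaneously. -/
theorem MeasurableMatrix.cfc [Countable ι] (he : ∀ x, IsParsevalFrame fun k => e k x)
    (h1 : MeasurableMatrix e fun x => (1 : H x →L[ℂ] H x)) (hA : MeasurableMatrix e A)
    (hsa : ∀ x, IsSelfAdjoint (A x)) {C : ℝ} (hC : ∀ x, ‖A x‖ ≤ C) {f : ℝ → ℝ}
    (hf : Continuous f) : MeasurableMatrix e fun x => cfc f (A x) := by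
  have hex : ∀ n : ℕ, ∃ p : Polynomial ℝ, ∀ y ∈ Set.Icc (-C) C,
      |p.eval y - f y| < 1 / ((n : ℝ) + 1) := fun n =>
    exists_polynomial_near_of_continuousOn _ _ f hf.continuousOn _ Nat.one_div_pos_of_nat
  choose p hp using hex
  refine MeasurableMatrix.of_tendsto (fun n => MeasurableMatrix.aeval he h1 hA (p n)) fun x => ?_
  rw [tendsto_iff_norm_sub_tendsto_zero]
  refine squeeze_zero (fun _ => norm_nonneg _) (fun n => ?_)
    tendsto_one_div_add_atTop_nhds_zero_nat
  rw [← cfc_polynomial (p n) (A x) (hsa x), ← cfc_sub (a := A x) (fun y => (p n).eval y) f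
    (p n).continuous.continuousOn hf.continuousOn]
  refine norm_cfc_le (by positivity) fun y hy => (hp n y ?_).le
  have h2 : ‖y‖ ≤ ‖A x‖ * ‖(1 : H x →L[ℂ] H x)‖ := spectrum.norm_le_norm_mul_of_mem hy
  have h3 : ‖(1 : H x →L[ℂ] H x)‖ ≤ 1 := ContinuousLinearMap.norm_id_le
  have h4 : ‖y‖ ≤ C := h2.trans ((mul_le_of_le_one_right (norm_nonneg _) h3).trans (hC x))
  exact abs_le.1 h4

theorem measurable_spectralMeasure_of_matrix [Countable ι]
    (he : ∀ x, IsParsevalFrame fun k => e k x)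
    (h1 : MeasurableMatrix e fun x => (1 : H x →L[ℂ] H x)) (hA : MeasurableMatrix e A)
    (hsa : ∀ x, IsSelfAdjoint (A x)) {C : ℝ} (hC : ∀ x, ‖A x‖ ≤ C) (k : ι) :
    Measurable fun x => spectralMeasure (A x) (e k x) := by
  have hint : ∀ f : ℝ → ℝ, Continuous f → (∀ y, 0 ≤ f y) →
      Measurable fun x => ∫⁻ y, ENNReal.ofReal (f y) ∂(spectralMeasure (A x) (e k x)) :=
    fun f hf h0 => by
    have h : ∀ x, ∫⁻ y, ENNReal.ofReal (f y) ∂(spectralMeasure (A x) (e k x))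
        = ENNReal.ofReal (inner ℂ (e k x) (_root_.cfc f (A x) (e k x))).re := fun x => by
      rw [← ofReal_integral_eq_lintegral_ofReal (integrable_spectralMeasure _ _ hf)
        (ae_of_all _ h0), integral_spectralMeasure_of_continuous _ _ hf]
    simp_rw [h]
    exact (Complex.measurable_re.comp (MeasurableMatrix.cfc he h1 hA hsa hC hf k k)).ennreal_ofReal
  -- Closed sets form a generating π-system, and the indicator of a closed set is a decreasing limit
  -- of continuous thickened indicators, whose integrals are matrix entries of functions of `A x`.
  refine Measurable.measure_of_isPiSystem (borel_eq_generateFrom_isClosed (α := ℝ) ▸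
    (BorelSpace.measurable_eq (α := ℝ))) isPiSystem_isClosed (fun s hs => ?_) ?_
  · have hlim : ∀ x, Tendsto (fun n : ℕ => ∫⁻ y, (thickenedIndicator
        (δ := 1 / ((n : ℝ) + 1)) Nat.one_div_pos_of_nat s y : ENNReal)
        ∂(spectralMeasure (A x) (e k x))) atTop (𝓝 (spectralMeasure (A x) (e k x) s)) :=
      fun x => tendsto_lintegral_thickenedIndicator_of_isClosed _ hs _
        tendsto_one_div_add_atTop_nhds_zero_nat
    refine measurable_of_tendsto_metrizable (fun n => ?_) (tendsto_pi_nhds.2 hlim)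
    have h := hint (fun y => (thickenedIndicator
        (δ := 1 / ((n : ℝ) + 1)) Nat.one_div_pos_of_nat s y : ℝ))
        (NNReal.continuous_coe.comp (thickenedIndicator _ s).continuous)
        (fun y => NNReal.coe_nonneg _)
    simpa only [ENNReal.ofReal_coe_nnreal] using h
  · have h := hint (fun _ => 1) continuous_const (fun _ => zero_le_one)
    simpa using h

end MeasurableMatrix

/-! ### Jointly measurable Lebesgue decomposition and atoms -/

section KernelDecomposition

open ProbabilityTheory

variable {X : Type*} [MeasurableSpace X]

/-- A jointly measurable choice of Lebesgue null sets off which the measures of a finite kernel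
are absolutely continuous. -/
theorem exists_singular_set (κ : Kernel X ℝ) [IsFiniteKernel κ] :
    ∃ N : Set (X × ℝ), MeasurableSet N ∧ ∀ x, volume (Prod.mk x ⁻¹' N) = 0 ∧
      (κ x).restrict (Prod.mk x ⁻¹' N)ᶜ ≪ volume := by
  -- Lebesgue measure is replaced by an equivalent finite measure, to which the decomposition of
  -- finite kernels applies.
  let η : Kernel X ℝ := Kernel.const X (volume : Measure ℝ).toFinite
  refine ⟨Kernel.mutuallySingularSet κ η, Kernel.measurableSet_mutuallySingularSet κ η,
    fun x => ⟨?_, ?_⟩⟩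
  · exact absolutelyContinuous_toFinite _ (Kernel.measure_mutuallySingularSetSlice κ η x)
  · refine Measure.AbsolutelyContinuous.trans ?_ (toFinite_absolutelyContinuous _)
    have hm := (Kernel.measurableSet_mutuallySingularSetSlice κ η x).compl
    refine Measure.AbsolutelyContinuous.mk fun s hs h => ?_
    rw [Measure.restrict_apply hs]
    have h1 := Kernel.withDensity_rnDeriv_of_subset_compl_mutuallySingularSetSlice
      (κ := κ) (η := η) (a := x) (hs.inter hm) Set.inter_subset_right
    refine h1.symm.trans ?_
    rw [Kernel.withDensity_apply _ (Kernel.measurable_rnDeriv κ η)]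
    exact withDensity_absolutelyContinuous _ _ (measure_mono_null Set.inter_subset_left h)

/-- The mass `κ x {y}` is the kernel measure of a slice of the diagonal, hence jointly measurable in
`(x, y)`. -/
theorem measurableSet_atoms (κ : Kernel X ℝ) [IsFiniteKernel κ] :
    MeasurableSet {p : X × ℝ | p.2 ∈ atomSet (κ p.1)} := by
  have h := Kernel.measurable_kernel_prodMk_left (κ := κ.comap (Prod.fst : X × ℝ → X) measurable_fst)
    (t := {p : (X × ℝ) × ℝ | p.2 = p.1.2})
    (measurableSet_eq_fun measurable_snd (measurable_snd.comp measurable_fst))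
  exact h (measurableSet_singleton 0).compl

end KernelDecomposition

/-! ### Measurable fields of selfadjoint operators -/

section MeasurableField

variable {X : Type*} [MeasurableSpace X] {H : X → Type*} [∀ x, NormedAddCommGroup (H x)]
  [∀ x, InnerProductSpace ℂ (H x)] [∀ x, CompleteSpace (H x)] {ι : Type*}

/-- A bounded measurable field of self-adjoint operators, measurability being tested on a field of
Parseval frames. -/
structure IsSelfAdjointField (e : ι → ∀ x, H x) (A : ∀ x, H x →L[ℂ] H x) : Prop where
  frame : ∀ x, IsParsevalFrame fun k => e k x
  gram : MeasurableMatrix e fun x => (1 : H x →L[ℂ] H x)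
  matrix : MeasurableMatrix e A
  selfAdjoint : ∀ x, IsSelfAdjoint (A x)
  bounded : ∃ C : ℝ, ∀ x, ‖A x‖ ≤ C

variable {e : ι → ∀ x, H x} {A : ∀ x, H x →L[ℂ] H x} [Countable ι]

/-- The kernel of spectral measures of the frame vector `e k`. -/
noncomputable def IsSelfAdjointField.kernel (h : IsSelfAdjointField e A) (k : ι) :
    ProbabilityTheory.Kernel X ℝ where
  toFun x := spectralMeasure (A x) (e k x)
  measurable' := by
    obtain ⟨C, hC⟩ := h.bounded
    exact measurable_spectralMeasure_of_matrix h.frame h.gram h.matrix h.selfAdjoint hC k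

instance (h : IsSelfAdjointField e A) (k : ι) :
    ProbabilityTheory.IsFiniteKernel (h.kernel k) :=
  ⟨⟨1, ENNReal.one_lt_top, fun x => by
    change spectralMeasure (A x) (e k x) Set.univ ≤ 1
    rw [spectralMeasure_univ (h.selfAdjoint x), ← ENNReal.ofReal_one]
    exact ENNReal.ofReal_le_ofReal (pow_le_one₀ (norm_nonneg _) ((h.frame x).norm_le_one k))⟩⟩

/-- The quantifier over all vectors of `H x` reduces, by `exists_cfc_ne_zero_iff`, to a countable
union over frame indices of conditions on kernel masses. -/
theorem IsSelfAdjointField.measurableSet_exists (h : IsSelfAdjointField e A)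
    {P : Measure ℝ → Prop} (hac : ∀ ν₁ ν₂, ν₁ ≪ ν₂ → P ν₂ → P ν₁) {B : ι → Set (X × ℝ)}
    (hB : ∀ k, MeasurableSet (B k))
    (hP : ∀ x k, P ((h.kernel k x).restrict (Prod.mk x ⁻¹' B k)))
    (hPc : ∀ x k ν, P ν → (h.kernel k x).restrict (Prod.mk x ⁻¹' B k)ᶜ ⟂ₘ ν)
    {f : ℝ → ℝ} (hf : Continuous f) :
    MeasurableSet {x | ∃ v, P (spectralMeasure (A x) v) ∧ cfc f (A x) v ≠ 0} := by
  have h1 : {x | ∃ v, P (spectralMeasure (A x) v) ∧ cfc f (A x) v ≠ 0}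
      = ⋃ k, {x | h.kernel k x (Prod.mk x ⁻¹' ((Set.univ ×ˢ {y | f y ≠ 0}) ∩ B k)) ≠ 0} := by
    ext x
    rw [Set.mem_iUnion]
    refine (exists_cfc_ne_zero_iff (h.selfAdjoint x) hac (h.frame x).eq_zero
      (fun k => measurable_prodMk_left (hB k)) (hP x) (hPc x) hf).trans ?_
    refine exists_congr fun k => ?_
    rw [Set.mem_ofPred_eq, Set.preimage_inter, Set.mk_preimage_prod_right (Set.mem_univ x)]
    rfl
  rw [h1]
  refine MeasurableSet.iUnion fun k => ?_
  exact ProbabilityTheory.Kernel.measurable_kernel_prodMk_left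
    ((MeasurableSet.univ.prod (measurableSet_ne_zero hf)).inter (hB k))
    (measurableSet_singleton 0).compl

theorem IsSelfAdjointField.measurableSet_exists_all (h : IsSelfAdjointField e A)
    {f : ℝ → ℝ} (hf : Continuous f) : MeasurableSet {x | ∃ v, cfc f (A x) v ≠ 0} := by
  have := h.measurableSet_exists (P := fun _ => True) (fun _ _ _ _ => trivial)
    (B := fun _ => Set.univ) (fun _ => MeasurableSet.univ) (fun _ _ => trivial)
    (fun x k ν _ => by simp) hf
  simpa using this

theorem IsSelfAdjointField.measurableSet_exists_ac (h : IsSelfAdjointField e A)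
    {f : ℝ → ℝ} (hf : Continuous f) :
    MeasurableSet {x | ∃ v ∈ acSubspace (A x), cfc f (A x) v ≠ 0} := by
  choose N hN hN0 hNac using fun k => exists_singular_set (h.kernel k)
  exact h.measurableSet_exists (P := fun ν => ν ≪ volume) (fun _ _ h h₂ => h.trans h₂)
    (B := fun k => (N k)ᶜ) (fun k => (hN k).compl) (fun x k => hNac k x)
    (fun x k ν hν => mutuallySingular_of_absolutelyContinuous
      (measurable_prodMk_left (hN k)) (hN0 k x) hν) hf

theorem IsSelfAdjointField.measurableSet_exists_sc (h : IsSelfAdjointField e A)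
    {f : ℝ → ℝ} (hf : Continuous f) :
    MeasurableSet {x | ∃ v ∈ scSubspace (A x), cfc f (A x) v ≠ 0} := by
  choose N hN hN0 hNac using fun k => exists_singular_set (h.kernel k)
  exact h.measurableSet_exists (P := IsSingCont)
    (fun _ _ h h₂ => ⟨fun x => h (h₂.1 x), h₂.2.mono_ac h Measure.AbsolutelyContinuous.rfl⟩)
    (B := fun k => N k ∩ {p : X × ℝ | p.2 ∈ atomSet (h.kernel k p.1)}ᶜ)
    (fun k => (hN k).inter (measurableSet_atoms _).compl)
    (fun x k => isSingCont_restrict (measurable_prodMk_left (hN k)) (hN0 k x))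
    (fun x k ν hν => mutuallySingular_of_isSingCont (hNac k x) hν) hf

theorem IsSelfAdjointField.measurableSet_exists_pp (h : IsSelfAdjointField e A)
    {f : ℝ → ℝ} (hf : Continuous f) :
    MeasurableSet {x | ∃ v ∈ ppSubspace (A x), cfc f (A x) v ≠ 0} :=
  h.measurableSet_exists (P := IsPurePoint) (fun _ _ h ⟨S, c, hS⟩ => ⟨S, c, h hS⟩)
    (B := fun k => {p : X × ℝ | p.2 ∈ atomSet (h.kernel k p.1)})
    (fun _ => measurableSet_atoms _) (fun _ _ => isPurePoint_restrict_atomSet _)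
    (fun _ _ _ hν => mutuallySingular_of_isPurePoint hν) hf

end MeasurableField

/-! ### Zero-one laws and the spectra of an ergodic field -/

section Ergodic

theorem exists_ae_iff_of_invariant {G X : Type*} [MeasurableSpace X] [VAdd G X] (μ : Measure X)
    [NeZero μ] [ErgodicVAdd G X μ] {κ : Type*} [Countable κ] {E : κ → Set X}
    (hE : ∀ q, MeasurableSet (E q)) (hinv : ∀ q (g : G) x, g +ᵥ x ∈ E q ↔ x ∈ E q) :
    ∃ p : κ → Prop, ∀ᵐ x ∂μ, ∀ q, x ∈ E q ↔ p q := by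
  have h : ∀ q, ∃ p : Prop, ∀ᵐ x ∂μ, x ∈ E q ↔ p := fun q => by
    have h1 : EventuallyConst (E q) (ae μ) :=
      ErgodicVAdd.aeconst_of_forall_preimage_vadd_ae_eq (G := G) (hE q) fun g => by
        rw [show (g +ᵥ ·) ⁻¹' E q = E q from Set.ext fun x => hinv q g x]
        exact ae_eq_rfl
    rcases eventuallyConst_set.1 h1 with h | h
    · exact ⟨True, h.mono fun x hx => by simpa using hx⟩
    · exact ⟨False, h.mono fun x hx => by simpa using hx⟩
  choose p hp using h
  exact ⟨p, ae_all_iff.2 hp⟩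

/-- If the functions `F k` are permuted transitively by measure preserving shifts, then their sum
is almost surely infinite or zero. -/
theorem ae_tsum_eq_top_or {G X : Type*} [MeasurableSpace X] [VAdd G X] {ι : Type*} [Countable ι]
    [Infinite ι] (μ : Measure X) [IsFiniteMeasure μ] [VAddInvariantMeasure G X μ]
    {F : ι → X → ENNReal} (hFm : ∀ k, Measurable (F k))
    (htrans : ∀ k l : ι, ∃ (g : G) (σ : ι ≃ ι), σ k = l ∧ ∀ j x, F (σ j) (g +ᵥ x) = F j x) :
    ∀ᵐ x ∂μ, ∑' k, F k x = ⊤ ∨ ∀ k, F k x = 0 := by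
  set N : X → ENNReal := fun x => ∑' k, F k x with hN
  have hNm : Measurable N := Measurable.tsum hFm
  have hNs : ∀ (g : G) (σ : ι ≃ ι), (∀ j x, F (σ j) (g +ᵥ x) = F j x) →
      ∀ x, N (g +ᵥ x) = N x := fun g σ hσ x =>
    (σ.tsum_eq fun k => F k (g +ᵥ x)).symm.trans (tsum_congr fun j => hσ j x)
  -- Cut off to the invariant event `N ≤ K`. There the `F l` have equal integrals while their
  -- infinite sum is at most `K μ(X)`, so each integral is zero.
  have hK : ∀ (K : ℕ) k, ∀ᵐ x ∂μ, N x ≤ K → F k x = 0 := fun K k => by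
    let S : Set X := {x | N x ≤ K}
    have hSm : MeasurableSet S := hNm measurableSet_Iic
    have hGm : ∀ k, Measurable (S.indicator (F k)) := fun k => (hFm k).indicator hSm
    have hconst : ∀ l, ∫⁻ x, S.indicator (F l) x ∂μ = ∫⁻ x, S.indicator (F k) x ∂μ := fun l => by
      obtain ⟨g, σ, rfl, hσ⟩ := htrans k l
      have hshift : ∀ x, S.indicator (F (σ k)) (g +ᵥ x) = S.indicator (F k) x := fun x => by
        have hiff : g +ᵥ x ∈ S ↔ x ∈ S := by
          change N (g +ᵥ x) ≤ K ↔ N x ≤ K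
          rw [hNs g σ hσ]
        by_cases hx : x ∈ S
        · rw [Set.indicator_of_mem hx, Set.indicator_of_mem (hiff.2 hx), hσ]
        · rw [Set.indicator_of_notMem hx, Set.indicator_of_notMem (fun h => hx (hiff.1 h))]
      -- Invariance is available only as equality of measures of preimages of measurable sets, so
      -- the integrals are compared through the laws of the two functions.
      have hmap : μ.map (S.indicator (F (σ k))) = μ.map (S.indicator (F k)) := by
        ext s hs
        rw [Measure.map_apply (hGm _) hs, Measure.map_apply (hGm _) hs,
          ← VAddInvariantMeasure.measure_preimage_vadd g (hGm (σ k) hs)]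
        congr 1
        ext x
        simp only [Set.mem_preimage, hshift]
      have h1 := lintegral_map (μ := μ) (f := fun y : ENNReal => y) measurable_id (hGm (σ k))
      have h2 := lintegral_map (μ := μ) (f := fun y : ENNReal => y) measurable_id (hGm k)
      rw [← h1, ← h2, hmap]
    have hsum : ∑' l, ∫⁻ x, S.indicator (F l) x ∂μ ≠ ⊤ := by
      rw [← lintegral_tsum fun l => (hGm l).aemeasurable]
      refine ne_top_of_le_ne_top (b := ∫⁻ _, (K : ENNReal) ∂μ) ?_ (lintegral_mono fun x => ?_)
      · rw [lintegral_const]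
        exact ENNReal.mul_ne_top (by simp) (measure_ne_top _ _)
      · by_cases hx : x ∈ S
        · simp only [Set.indicator_of_mem hx]
          exact hx
        · simp [Set.indicator_of_notMem hx]
    rw [tsum_congr hconst] at hsum
    have h0 : ∫⁻ x, S.indicator (F k) x ∂μ = 0 := by
      by_contra h0
      exact hsum (ENNReal.tsum_const_eq_top_of_ne_zero h0)
    rw [lintegral_eq_zero_iff (hGm k)] at h0
    filter_upwards [h0] with x hx hxK
    rwa [Set.indicator_of_mem (show x ∈ S from hxK)] at hx
  filter_upwards [ae_all_iff.2 fun K => ae_all_iff.2 (hK K)] with x hx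
  by_cases hx' : N x = ⊤
  · exact Or.inl hx'
  · obtain ⟨K, hKx⟩ := ENNReal.exists_nat_gt hx'
    exact Or.inr fun k => hx K k hKx.le

/-- A point of the discrete spectrum yields a tent function of finite nonzero trace. -/
theorem exists_tent_of_mem_discSpectrum {H : Type*} [NormedAddCommGroup H] [InnerProductSpace ℂ H]
    [CompleteSpace H] {T : H →L[ℂ] H} (hT : IsSelfAdjoint T) {ι : Type*} {e : ι → H}
    (he : IsParsevalFrame e) {z : ℂ} (hz : z ∈ discSpectrum T) :
    ∃ q, ∑' k, ∫⁻ y, ENNReal.ofReal (tent q y) ∂(spectralMeasure T (e k)) ≠ ⊤ ∧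
      ∃ k, ∫⁻ y, ENNReal.ofReal (tent q y) ∂(spectralMeasure T (e k)) ≠ 0 := by
  obtain ⟨⟨ε, hε, hiso⟩, -, hfin⟩ := hz
  have hzs : z ∈ spectrum ℂ T := (hiso.symm ▸ Set.mem_singleton z : z ∈ spectrum ℂ T ∩ _).1
  have hzs' := hzs
  rw [spectrum_eq hT] at hzs'
  obtain ⟨x, hx, rfl⟩ := hzs'
  obtain ⟨q, hq, hq'⟩ := exists_tent x hε
  have hc := continuous_tent q
  set V := Module.End.eigenspace (T : Module.End ℂ H) (x : ℂ) with hV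
  -- The support of the tent meets the spectrum only at `x`, so `(y - x) tent(y)` vanishes on the
  -- spectrum and `tent(T)` maps into the eigenspace.
  have hmem : ∀ v, cfc (tent q) T v ∈ V := fun v => by
    rw [hV, Module.End.mem_eigenspace_iff]
    have h1 : cfc (fun y => y - x) T (cfc (tent q) T v) = 0 := by
      rw [cfc_mul_apply T (by fun_prop) hc]
      have h2 : cfc (fun y => (y - x) * tent q y) T = cfc (fun _ : ℝ => (0 : ℝ)) T :=
        cfc_congr fun y hy => by
          by_cases hy' : tent q y = 0
          · simp [hy']
          · have h3 : (y : ℂ) ∈ spectrum ℂ T ∩ Metric.ball (x : ℂ) ε := by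
              refine ⟨?_, ?_⟩
              · rw [← hT.spectrumRestricts.algebraMap_image]
                exact ⟨y, hy, rfl⟩
              · rw [Metric.mem_ball, dist_eq_norm, ← Complex.ofReal_sub, Complex.norm_real]
                exact hq' y hy'
            rw [hiso, Set.mem_singleton_iff, Complex.ofReal_inj] at h3
            simp [h3]
      rw [h2, cfc_const_zero ℝ T]
      rfl
    rw [cfc_sub (a := T) (fun y : ℝ => y) (fun _ => x) (by fun_prop) (by fun_prop),
      cfc_id' ℝ T, cfc_const x T, Algebra.algebraMap_eq_smul_one] at h1
    change T (cfc (tent q) T v) - x • cfc (tent q) T v = 0 at h1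
    rw [Complex.coe_smul]
    exact sub_eq_zero.1 h1
  have hval : ∀ k, ∫⁻ y, ENNReal.ofReal (tent q y) ∂(spectralMeasure T (e k))
      = ENNReal.ofReal (inner ℂ (e k) (cfc (tent q) T (e k))).re := fun k => by
    rw [← ofReal_integral_eq_lintegral_ofReal (integrable_spectralMeasure _ _ hc)
      (ae_of_all _ (tent_nonneg q)), integral_spectralMeasure_of_continuous _ _ hc]
  refine ⟨q, ?_, ?_⟩
  · let b := stdOrthonormalBasis ℂ V
    -- Expanding in a finite orthonormal basis of the eigenspace turns the trace into finitely many
    -- Parseval sums, each summable.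
    have hexp : ∀ k, inner ℂ (e k) (cfc (tent q) T (e k))
        = ∑ j, inner ℂ (cfc (tent q) T (b j : H)) (e k) * inner ℂ (e k) (b j : H) := fun k => by
      have h1 := b.sum_repr' ⟨_, hmem (e k)⟩
      have h2 := congrArg (fun w : V => inner ℂ (e k) (w : H)) h1
      simp only [Submodule.coe_sum, Submodule.coe_smul, Submodule.coe_inner, inner_sum,
        inner_smul_right] at h2
      rw [← h2]
      simp only [inner_cfc_left]
    have hsum : Summable fun k => inner ℂ (e k) (cfc (tent q) T (e k)) := by
      simp_rw [hexp]
      exact summable_sum fun j _ => (he _ _).summable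
    have hre : Summable fun k => (inner ℂ (e k) (cfc (tent q) T (e k))).re :=
      (Complex.hasSum_re hsum.hasSum).summable
    simp_rw [hval]
    exact hre.tsum_ofReal_ne_top
  · by_contra! h0
    obtain ⟨v, hv⟩ := hx q hq
    refine hv ((cfc_apply_eq_zero_iff hT hc v).2 ?_)
    refine spectralMeasure_eq_zero_of_total hT he.eq_zero (fun k => ?_) v
    have h1 := h0 k
    rw [lintegral_eq_zero_iff hc.measurable.ennreal_ofReal] at h1
    refine measure_mono_null (fun y hy => ?_) (ae_iff.1 h1)
    simp only [Set.mem_ofPred_eq, Pi.zero_apply, ENNReal.ofReal_eq_zero, not_le]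
    exact lt_of_le_of_ne (tent_nonneg q y) (Ne.symm hy)

theorem exists_mem_spectralSubspace_iff {H H' : Type*} [NormedAddCommGroup H]
    [InnerProductSpace ℂ H] [CompleteSpace H] [NormedAddCommGroup H'] [InnerProductSpace ℂ H']
    [CompleteSpace H'] (U : H ≃ₗᵢ[ℂ] H') {T : H →L[ℂ] H} {T' : H' →L[ℂ] H'}
    (hT : IsSelfAdjoint T) (h : ∀ v, T' (U v) = U (T v)) (P : Measure ℝ → Prop) {f : ℝ → ℝ}
    (hf : Continuous f) :
    (∃ v, P (spectralMeasure T' v) ∧ cfc f T' v ≠ 0) ↔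
      ∃ v, P (spectralMeasure T v) ∧ cfc f T v ≠ 0 := by
  refine U.surjective.exists.trans (exists_congr fun v => ?_)
  rw [spectralMeasure_unitary U hT h, cfc_unitary U hT h hf, map_ne_zero_iff U U.injective]

theorem acSpectrum_eq {H : Type*} [NormedAddCommGroup H] [InnerProductSpace ℂ H]
    [CompleteSpace H] {T : H →L[ℂ] H} (hT : IsSelfAdjoint T) :
    acSpectrum T = Complex.ofReal ''
      {x | ∀ q, tent q x ≠ 0 → ∃ v ∈ acSubspace T, cfc (tent q) T v ≠ 0} :=
  spectrum_restrict_eq hT _ (cfc_mem_spectralSubspace T _ _ _)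

theorem scSpectrum_eq {H : Type*} [NormedAddCommGroup H] [InnerProductSpace ℂ H]
    [CompleteSpace H] {T : H →L[ℂ] H} (hT : IsSelfAdjoint T) :
    scSpectrum T = Complex.ofReal ''
      {x | ∀ q, tent q x ≠ 0 → ∃ v ∈ scSubspace T, cfc (tent q) T v ≠ 0} :=
  spectrum_restrict_eq hT _ (cfc_mem_spectralSubspace T _ _ _)

theorem ppSpectrum_eq {H : Type*} [NormedAddCommGroup H] [InnerProductSpace ℂ H]
    [CompleteSpace H] {T : H →L[ℂ] H} (hT : IsSelfAdjoint T) :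
    ppSpectrum T = Complex.ofReal ''
      {x | ∀ q, tent q x ≠ 0 → ∃ v ∈ ppSubspace T, cfc (tent q) T v ≠ 0} :=
  spectrum_restrict_eq hT _ (cfc_mem_spectralSubspace T _ _ _)

variable {G X : Type*} [MeasurableSpace X] [VAdd G X] {H : X → Type*}
  [∀ x, NormedAddCommGroup (H x)] [∀ x, InnerProductSpace ℂ (H x)] [∀ x, CompleteSpace (H x)]
  {ι : Type*} {e : ι → ∀ x, H x} {A : ∀ x, H x →L[ℂ] H x} [Countable ι]

/-- Almost surely `f(A)`, `f ≥ 0`, has infinite trace or vanishes. -/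
theorem IsSelfAdjointField.ae_trace_eq_top_or [Infinite ι] (h : IsSelfAdjointField e A)
    (μ : Measure X) [IsFiniteMeasure μ] [VAddInvariantMeasure G X μ]
    (U : ∀ (g : G) x, H x ≃ₗᵢ[ℂ] H (g +ᵥ x)) (hU : ∀ g x v, A (g +ᵥ x) (U g x v) = U g x (A x v))
    (htrans : ∀ k l : ι, ∃ (g : G) (σ : ι ≃ ι), σ k = l ∧ ∀ j x, U g x (e j x) = e (σ j) (g +ᵥ x))
    {f : ℝ → ENNReal} (hf : Measurable f) :
    ∀ᵐ x ∂μ, ∑' k, ∫⁻ y, f y ∂(spectralMeasure (A x) (e k x)) = ⊤ ∨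
      ∀ k, ∫⁻ y, f y ∂(spectralMeasure (A x) (e k x)) = 0 := by
  refine ae_tsum_eq_top_or (G := G) μ (fun k => hf.lintegral_kernel (κ := h.kernel k))
    fun k l => ?_
  obtain ⟨g, σ, hσ, hσ'⟩ := htrans k l
  refine ⟨g, σ, hσ, fun j x => ?_⟩
  rw [← hσ', spectralMeasure_unitary (U g x) (h.selfAdjoint x) (hU g x)]

/-- The spectral types of an ergodic covariant field of self-adjoint operators are almost surely
constant, and its discrete spectrum is almost surely empty. -/
theorem IsSelfAdjointField.exists_ae_spectrum_eq [Infinite ι] (h : IsSelfAdjointField e A)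
    (μ : Measure X) [IsProbabilityMeasure μ] [ErgodicVAdd G X μ]
    (U : ∀ (g : G) x, H x ≃ₗᵢ[ℂ] H (g +ᵥ x)) (hU : ∀ g x v, A (g +ᵥ x) (U g x v) = U g x (A x v))
    (htrans : ∀ k l : ι, ∃ (g : G) (σ : ι ≃ ι),
      σ k = l ∧ ∀ j x, U g x (e j x) = e (σ j) (g +ᵥ x)) :
    ∃ S Sac Ssc Spp Sess : Set ℝ, ∀ᵐ x ∂μ,
      spectrum ℂ (A x) = Complex.ofReal '' S ∧
      acSpectrum (A x) = Complex.ofReal '' Sac ∧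
      scSpectrum (A x) = Complex.ofReal '' Ssc ∧
      ppSpectrum (A x) = Complex.ofReal '' Spp ∧
      essSpectrum (A x) = Complex.ofReal '' Sess ∧
      discSpectrum (A x) = ∅ := by
  obtain ⟨p, hp⟩ := exists_ae_iff_of_invariant (G := G) μ
    (fun q => h.measurableSet_exists_all (continuous_tent q)) fun q g x => by
      have := exists_mem_spectralSubspace_iff (U g x) (h.selfAdjoint x) (hU g x)
        (fun _ => True) (continuous_tent q)
      simpa using this
  obtain ⟨pac, hpac⟩ := exists_ae_iff_of_invariant (G := G) μ
    (fun q => h.measurableSet_exists_ac (continuous_tent q)) fun q g x =>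
      exists_mem_spectralSubspace_iff (U g x) (h.selfAdjoint x) (hU g x) (fun ν => ν ≪ volume)
        (continuous_tent q)
  obtain ⟨psc, hpsc⟩ := exists_ae_iff_of_invariant (G := G) μ
    (fun q => h.measurableSet_exists_sc (continuous_tent q)) fun q g x =>
      exists_mem_spectralSubspace_iff (U g x) (h.selfAdjoint x) (hU g x) IsSingCont
        (continuous_tent q)
  obtain ⟨ppp, hppp⟩ := exists_ae_iff_of_invariant (G := G) μ
    (fun q => h.measurableSet_exists_pp (continuous_tent q)) fun q g x =>
      exists_mem_spectralSubspace_iff (U g x) (h.selfAdjoint x) (hU g x) IsPurePoint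
        (continuous_tent q)
  refine ⟨{y | ∀ q, tent q y ≠ 0 → p q}, {y | ∀ q, tent q y ≠ 0 → pac q},
    {y | ∀ q, tent q y ≠ 0 → psc q}, {y | ∀ q, tent q y ≠ 0 → ppp q},
    {y | ∀ q, tent q y ≠ 0 → p q}, ?_⟩
  -- Countably many tents suffice, so one null set serves for every possible point of the discrete
  -- spectrum.
  have hdisc := ae_all_iff.2 fun q : ℚ × ℚ => h.ae_trace_eq_top_or μ U hU htrans
    (continuous_tent q).measurable.ennreal_ofReal
  filter_upwards [hp, hpac, hpsc, hppp, hdisc] with x h1 h2 h3 h4 h5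
  have hsa := h.selfAdjoint x
  have hS : spectrum ℂ (A x) = Complex.ofReal '' {y | ∀ q, tent q y ≠ 0 → p q} := by
    rw [spectrum_eq hsa]
    congr! 4 with y q
    exact forall_congr' fun _ => h1 q
  have hD : discSpectrum (A x) = ∅ := by
    refine Set.eq_empty_of_forall_notMem fun z hz => ?_
    obtain ⟨q, hq1, k, hq2⟩ := exists_tent_of_mem_discSpectrum hsa (h.frame x) hz
    rcases h5 q with h | h
    · exact hq1 h
    · exact hq2 (h k)
  refine ⟨hS, ?_, ?_, ?_, ?_, hD⟩
  · rw [acSpectrum_eq hsa]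
    congr! 4 with y q
    exact forall_congr' fun _ => h2 q
  · rw [scSpectrum_eq hsa]
    congr! 4 with y q
    exact forall_congr' fun _ => h3 q
  · rw [ppSpectrum_eq hsa]
    congr! 4 with y q
    exact forall_congr' fun _ => h4 q
  · rw [essSpectrum, hD, Set.sdiff_empty, hS]

end Ergodic

/-! ### The natural topology, lattice cells and the cell frame -/

section ClosedSubsets

variable {d : ℕ}

/-- A compact `K` missed by `F` has positive distance from `F`, so sets locally close to `F` on a
ball containing `K` miss `K` too. This is the link between the natural topology and Borel events
about points of `ω`. -/
theorem isOpen_setOf_disjoint {K : Set (EuclideanSpace ℝ (Fin d))} (hK : IsCompact K) :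
    IsOpen {F : ClosedSubset d | Disjoint F.carrier K} := by
  intro F hF
  obtain ⟨δ, hδ, hdisj⟩ := (Disjoint.symm hF).exists_thickenings hK F.isClosed
  obtain ⟨ρ, hρ⟩ := hK.isBounded.subset_closedBall 0
  obtain ⟨n, hn⟩ := exists_nat_ge ρ
  -- Staying strictly below `1` rules out the default value in `localDist`, and staying below `δ`
  -- keeps the thickenings disjoint.
  refine ⟨min δ 1 / 2, by positivity, n, fun G hG => ?_⟩
  have hlt : localDist n F G < min δ 1 :=
    lt_of_le_of_lt hG (half_lt_self (lt_min hδ one_pos))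
  unfold localDist at hlt
  obtain ⟨ε, hε, hεlt⟩ := exists_lt_of_csInf_lt (by exact ⟨1, Or.inr rfl⟩) hlt
  rcases hε with ⟨-, -, hε⟩ | hε
  · refine Set.disjoint_left.2 fun x hxG hxK => ?_
    have h1 := hε ⟨hxG, Metric.closedBall_subset_closedBall hn (hρ hxK)⟩
    have h2 := Metric.thickening_mono (hεlt.le.trans (min_le_left _ _)) _ h1
    exact Set.disjoint_left.1 hdisj (Metric.self_subset_thickening hδ _ hxK) h2
  · rw [Set.mem_singleton_iff.1 hε] at hεlt
    exact absurd (hεlt.trans_le (min_le_right _ _)) (lt_irrefl _)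

/-- The index of the cell of the lattice `s ℤ^d` that contains `x`. -/
noncomputable def cellIndex (s : ℝ) (x : EuclideanSpace ℝ (Fin d)) : Fin d → ℤ :=
  fun i => ⌊x i / s⌋

theorem measurable_cellIndex (s : ℝ) :
    Measurable (cellIndex s : EuclideanSpace ℝ (Fin d) → Fin d → ℤ) := by
  unfold cellIndex
  fun_prop

theorem cellIndex_eq_iff {s : ℝ} (hs : 0 < s) {x : EuclideanSpace ℝ (Fin d)} {k : Fin d → ℤ} :
    cellIndex s x = k ↔ ∀ i, k i * s ≤ x i ∧ x i < (k i + 1) * s := by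
  rw [funext_iff]
  refine forall_congr' fun i => ?_
  rw [cellIndex, Int.floor_eq_iff, le_div_iff₀ hs, div_lt_iff₀ hs]

theorem cellIndex_sub {s : ℝ} (hs : 0 < s) (x : EuclideanSpace ℝ (Fin d)) (m : Fin d → ℤ) :
    cellIndex s (x - WithLp.toLp 2 fun i => (m i : ℝ) * s) = cellIndex s x - m := by
  ext i
  simp only [cellIndex, PiLp.sub_apply, Pi.sub_apply]
  rw [sub_div, mul_div_cancel_right₀ _ hs.ne', Int.floor_sub_intCast]

/-- Two points of a cell of side `r/d` have squared distance below `d (r/d)² = r²/d ≤ r²`, against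
the separation `r`. -/
theorem IsDeloneSet.injOn_cellIndex (hd : 1 ≤ d) {r R : ℝ} (hr : 0 < r) {ω : ClosedSubset d}
    (hω : IsDeloneSet r R ω) : Set.InjOn (cellIndex (r / d)) ω.carrier := by
  intro x hx y hy hxy
  by_contra hne
  have hd0 : (0 : ℝ) < d := by exact_mod_cast hd
  have h1 := hω.1 x hx y hy hne
  have hs : 0 < r / d := by positivity
  have hx' := (cellIndex_eq_iff hs (x := x)).1 rfl
  have hy' := (cellIndex_eq_iff hs (x := y)).1 hxy.symm
  have h2 : dist x y ^ 2 < r ^ 2 := by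
    rw [EuclideanSpace.dist_eq, Real.sq_sqrt (Finset.sum_nonneg fun _ _ => sq_nonneg _)]
    have hne' : (Finset.univ : Finset (Fin d)).Nonempty := ⟨⟨0, hd⟩, Finset.mem_univ _⟩
    calc ∑ i, dist (x i) (y i) ^ 2 < ∑ _i : Fin d, (r / d) ^ 2 := by
          refine Finset.sum_lt_sum_of_nonempty hne' fun i _ => ?_
          rw [Real.dist_eq]
          refine pow_lt_pow_left₀ ?_ (abs_nonneg _) two_ne_zero
          rw [abs_lt]
          constructor <;> linarith [(hx' i).1, (hx' i).2, (hy' i).1, (hy' i).2]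
      _ = r ^ 2 / d := by
          rw [Finset.sum_const, Finset.card_univ, Fintype.card_fin, nsmul_eq_mul]
          field_simp
      _ ≤ r ^ 2 := div_le_self (sq_nonneg r) (by exact_mod_cast hd)
  have h3 : r ^ 2 ≤ dist x y ^ 2 := pow_le_pow_left₀ hr.le h1 2
  linarith

/-- A half-open cell is a countable union of compact boxes, and hitting a compact set is a closed
condition. -/
theorem measurableSet_exists_cellIndex_eq {s : ℝ} (hs : 0 < s) (k : Fin d → ℤ) :
    MeasurableSet {F : ClosedSubset d | ∃ x ∈ F.carrier, cellIndex s x = k} := by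
  let K : ℕ → Set (EuclideanSpace ℝ (Fin d)) := fun n =>
    (EuclideanSpace.equiv (Fin d) ℝ) ⁻¹'
      Set.Icc (fun i => k i * s) (fun i => (k i + 1) * s - 1 / ((n : ℝ) + 1))
  have hK : ∀ n, IsCompact (K n) := fun n =>
    (EuclideanSpace.equiv (Fin d) ℝ).toHomeomorph.isCompact_preimage.2 isCompact_Icc
  have h1 : {F : ClosedSubset d | ∃ x ∈ F.carrier, cellIndex s x = k}
      = ⋃ n, {F : ClosedSubset d | Disjoint F.carrier (K n)}ᶜ := by
    ext F
    simp only [Set.mem_ofPred_eq, Set.mem_iUnion, Set.mem_compl_iff, Set.not_disjoint_iff]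
    constructor
    · rintro ⟨x, hx, hxk⟩
      rw [cellIndex_eq_iff hs] at hxk
      have hn : ∀ i, ∃ n : ℕ, 1 / ((n : ℝ) + 1) < (k i + 1) * s - x i := fun i =>
        exists_nat_one_div_lt (sub_pos.2 (hxk i).2)
      choose n hn using hn
      refine ⟨Finset.univ.sup n, x, hx, fun i => (hxk i).1, fun i => ?_⟩
      have h2 : 1 / (((Finset.univ.sup n : ℕ) : ℝ) + 1) ≤ 1 / ((n i : ℝ) + 1) :=
        Nat.one_div_le_one_div (Finset.le_sup (Finset.mem_univ i))
      have h3 := hn i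
      change x i ≤ _
      linarith
    · rintro ⟨n, x, hx, h2, h3⟩
      refine ⟨x, hx, (cellIndex_eq_iff hs).2 fun i => ⟨h2 i, ?_⟩⟩
      have h4 : x i ≤ (k i + 1) * s - 1 / ((n : ℝ) + 1) := h3 i
      have h5 : 0 < 1 / ((n : ℝ) + 1) := Nat.one_div_pos_of_nat
      linarith
  rw [h1]
  exact MeasurableSet.iUnion fun n => (isOpen_setOf_disjoint (hK n)).measurableSet.compl

/-- The indicator function of the cell `k` of the lattice `s ℤ^d`, restricted to `ω`. -/
noncomputable def cellVector {s : ℝ} {ω : ClosedSubset d}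
    (h : Set.InjOn (cellIndex s) ω.carrier) (k : Fin d → ℤ) : L2 ω :=
  ⟨fun x => if cellIndex s (x : EuclideanSpace ℝ (Fin d)) = k then 1 else 0, by
    refine (memℓp_gen_iff (by norm_num)).2 (summable_of_hasFiniteSupport ?_)
    refine Set.Subsingleton.finite fun x hx y hy => Subtype.ext (h x.2 y.2 ?_)
    have hmem : ∀ x : ω.carrier, x ∈ Function.support (fun x : ω.carrier =>
        ‖(if cellIndex s (x : EuclideanSpace ℝ (Fin d)) = k then 1 else 0 : ℂ)‖
          ^ (2 : ENNReal).toReal) → cellIndex s (x : EuclideanSpace ℝ (Fin d)) = k := fun x hx => by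
      by_contra hne
      exact hx (by simp [hne])
    exact (hmem x hx).trans (hmem y hy).symm⟩

theorem cellVector_apply {s : ℝ} {ω : ClosedSubset d} (h : Set.InjOn (cellIndex s) ω.carrier)
    (k : Fin d → ℤ) (x : ω.carrier) :
    cellVector h k x = if cellIndex s (x : EuclideanSpace ℝ (Fin d)) = k then 1 else 0 := rfl

theorem inner_cellVector_self {s : ℝ} {ω : ClosedSubset d}
    (h : Set.InjOn (cellIndex s) ω.carrier) (x : ω.carrier) (v : L2 ω) :
    inner ℂ (cellVector h (cellIndex s (x : EuclideanSpace ℝ (Fin d)))) v = v x := by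
  refine (lp.hasSum_inner _ v).unique ?_
  convert hasSum_single x fun y hy => ?_ using 1
  · rw [cellVector_apply, if_pos rfl]
    simp
  · rw [cellVector_apply, if_neg fun hne => hy (Subtype.ext (h y.2 x.2 hne))]
    simp

theorem cellVector_eq_zero {s : ℝ} {ω : ClosedSubset d} (h : Set.InjOn (cellIndex s) ω.carrier)
    {k : Fin d → ℤ} (hk : ∀ x ∈ ω.carrier, cellIndex s x ≠ k) : cellVector h k = 0 := by
  ext x
  rw [cellVector_apply, if_neg (hk x x.2)]
  rfl

/-- Occupied cells correspond to the points of `ω` and give the delta basis; empty cells contribute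
zero vectors. -/
theorem isParsevalFrame_cellVector {s : ℝ} {ω : ClosedSubset d}
    (h : Set.InjOn (cellIndex s) ω.carrier) : IsParsevalFrame (cellVector h) := fun u v => by
  have hinj : Function.Injective fun x : ω.carrier =>
      cellIndex s (x : EuclideanSpace ℝ (Fin d)) :=
    fun x y hxy => Subtype.ext (h x.2 y.2 hxy)
  rw [← hinj.hasSum_iff fun k hk => ?_]
  · refine (lp.hasSum_inner u v).congr_fun fun x => ?_
    change inner ℂ u (cellVector h _) * inner ℂ (cellVector h _) v = _
    rw [← inner_conj_symm u, inner_cellVector_self, inner_cellVector_self, RCLike.inner_apply,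
      mul_comm]
  · rw [cellVector_eq_zero h fun x hx hxk => hk ⟨⟨x, hx⟩, hxk⟩]
    simp

theorem inner_cellVector_cellVector {s : ℝ} {ω : ClosedSubset d}
    (h : Set.InjOn (cellIndex s) ω.carrier) (k l : Fin d → ℤ)
    [Decidable (∃ x ∈ ω.carrier, cellIndex s x = k)] :
    inner ℂ (cellVector h k) (cellVector h l)
      = if k = l then (if ∃ x ∈ ω.carrier, cellIndex s x = k then 1 else 0) else 0 := by
  by_cases hk : ∃ x ∈ ω.carrier, cellIndex s x = k
  · rw [if_pos hk]
    obtain ⟨x, hx, rfl⟩ := hk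
    rw [inner_cellVector_self h ⟨x, hx⟩, cellVector_apply]
  · rw [if_neg hk, cellVector_eq_zero h fun x hx hxk => hk ⟨x, hx, hxk⟩]
    simp

theorem translateUnitary_cellVector {s : ℝ} (hs : 0 < s) {ω : ClosedSubset d}
    (h : Set.InjOn (cellIndex s) ω.carrier) (m j : Fin d → ℤ)
    (h' : Set.InjOn (cellIndex s)
      ((WithLp.toLp 2 fun i => (m i : ℝ) * s : EuclideanSpace ℝ (Fin d)) +ᵥ ω).carrier) :
    translateUnitary _ ω (cellVector h j) = cellVector h' (j + m) := by
  ext x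
  rw [cellVector_apply]
  change cellVector h j ((translateEquiv _ ω).symm x) = _
  rw [cellVector_apply]
  change (if cellIndex s ((x : EuclideanSpace ℝ (Fin d)) - _) = j then (1 : ℂ) else 0) = _
  exact if_congr (by rw [cellIndex_sub hs, sub_eq_iff_eq_add]) rfl rfl

end ClosedSubsets

/-! ### Random operators as measurable fields -/

section RandomOperatorField

/-- Over a countable frame this expresses selfadjointness by countably many equations between matrix
entries, so it is a measurable event. -/
theorem isSelfAdjoint_iff_of_frame {H : Type*} [NormedAddCommGroup H] [InnerProductSpace ℂ H]
    [CompleteSpace H] {ι : Type*} {e : ι → H} (he : IsParsevalFrame e) (T : H →L[ℂ] H) :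
    IsSelfAdjoint T ↔
      ∀ k l, inner ℂ (e k) (T (e l)) = (starRingEnd ℂ) (inner ℂ (e l) (T (e k))) := by
  constructor
  · intro hT k l
    rw [inner_conj_symm]
    exact (hT.isSymmetric (e k) (e l)).symm
  · intro h
    have h1 : ∀ l, ContinuousLinearMap.adjoint T (e l) = T (e l) := fun l => by
      rw [← sub_eq_zero]
      refine he.eq_zero _ fun k => ?_
      rw [inner_sub_right, ContinuousLinearMap.adjoint_inner_right, h k l, inner_conj_symm,
        sub_self]
    rw [ContinuousLinearMap.isSelfAdjoint_iff']
    ext v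
    rw [← sub_eq_zero]
    refine he.eq_zero _ fun k => ?_
    rw [inner_sub_right, ContinuousLinearMap.adjoint_inner_right,
      ← ContinuousLinearMap.adjoint_inner_left, h1, sub_self]

variable {d : ℕ} {Ω : SubAddAction (EuclideanSpace ℝ (Fin d)) (ClosedSubset d)}

instance : BorelSpace (Bundle Ω) := ⟨rfl⟩

theorem isMeasurableSection_cellVector {s : ℝ}
    (h : ∀ ω : Ω, Set.InjOn (cellIndex s) (ω : ClosedSubset d).carrier) (k : Fin d → ℤ) :
    IsMeasurableSection fun ω : Ω => cellVector (h ω) k := by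
  have hc : Continuous fun p : Bundle Ω => p.1.2 := continuous_snd.comp continuous_subtype_val
  have hm : Measurable fun p : Bundle Ω => cellIndex s p.1.2 :=
    (measurable_cellIndex s).comp hc.measurable
  exact Measurable.ite (hm (measurableSet_singleton k)) measurable_const measurable_const

open Classical in
/-- The family that agrees with `A` where `A` is self-adjoint, and vanishes elsewhere. -/
noncomputable def selfAdjointPart
    (A : ∀ ω : Ω, L2 (ω : ClosedSubset d) →L[ℂ] L2 (ω : ClosedSubset d)) (ω : Ω) :
    L2 (ω : ClosedSubset d) →L[ℂ] L2 (ω : ClosedSubset d) :=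
  if IsSelfAdjoint (A ω) then A ω else 0

variable {A : ∀ ω : Ω, L2 (ω : ClosedSubset d) →L[ℂ] L2 (ω : ClosedSubset d)}

/-- Selfadjointness is assumed only almost surely, but a field requires it everywhere. Replacing `A
ω` by zero on the measurable exceptional set repairs this; the set is also invariant, so covariance
persists. -/
theorem IsRandomOperator.isSelfAdjointField (hA : IsRandomOperator A) {s : ℝ} (hs : 0 < s)
    (h : ∀ ω : Ω, Set.InjOn (cellIndex s) (ω : ClosedSubset d).carrier) :
    IsSelfAdjointField (H := fun ω : Ω => L2 (ω : ClosedSubset d))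
      (fun k ω => cellVector (h ω) k) (selfAdjointPart A) := by
  classical
  have hmat : MeasurableMatrix (H := fun ω : Ω => L2 (ω : ClosedSubset d))
      (fun k ω => cellVector (h ω) k) A := fun k l =>
    hA.measurable _ _ (isMeasurableSection_cellVector h k) (isMeasurableSection_cellVector h l)
  have hS : MeasurableSet {ω : Ω | IsSelfAdjoint (A ω)} := by
    simp_rw [fun ω : Ω => isSelfAdjoint_iff_of_frame (isParsevalFrame_cellVector (h ω)) (A ω),
      Set.ofPred_forall]
    exact MeasurableSet.iInter fun k => MeasurableSet.iInter fun l =>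
      measurableSet_eq_fun (hmat k l) (Complex.continuous_conj.measurable.comp (hmat l k))
  refine ⟨fun ω => isParsevalFrame_cellVector (h ω), fun k l => ?_, fun k l => ?_, fun ω => ?_, ?_⟩
  · simp only [one_apply_eq_self, inner_cellVector_cellVector]
    by_cases hkl : k = l
    · simp only [hkl, if_true]
      exact Measurable.ite (measurable_subtype_coe (measurableSet_exists_cellIndex_eq hs l))
        measurable_const measurable_const
    · simp only [hkl, if_false]
      exact measurable_const
  · have h1 : ∀ ω : Ω, inner ℂ (cellVector (h ω) k) (selfAdjointPart A ω (cellVector (h ω) l))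
        = if IsSelfAdjoint (A ω) then inner ℂ (cellVector (h ω) k) (A ω (cellVector (h ω) l))
          else 0 := fun ω => by
      rw [selfAdjointPart]
      split_ifs <;> simp
    simp_rw [h1]
    exact Measurable.ite hS (hmat k l) measurable_const
  · rw [selfAdjointPart]
    split_ifs with hω
    · exact hω
    · exact IsSelfAdjoint.zero _
  · obtain ⟨C, hC⟩ := hA.bounded
    refine ⟨max C 0, fun ω => ?_⟩
    rw [selfAdjointPart]
    split_ifs with hω
    · exact (hC ω).trans (le_max_left _ _)
    · rw [norm_zero]
      exact le_max_right _ _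

theorem isSelfAdjoint_of_unitary {H H' : Type*} [NormedAddCommGroup H] [InnerProductSpace ℂ H]
    [CompleteSpace H] [NormedAddCommGroup H'] [InnerProductSpace ℂ H'] [CompleteSpace H']
    (U : H ≃ₗᵢ[ℂ] H') {T : H →L[ℂ] H} {T' : H' →L[ℂ] H'} (h : ∀ v, T' (U v) = U (T v)) :
    IsSelfAdjoint T' ↔ IsSelfAdjoint T := by
  simp only [ContinuousLinearMap.isSelfAdjoint_iff_isSymmetric, LinearMap.IsSymmetric]
  simp only [U.surjective.forall, ContinuousLinearMap.coe_coe, h, U.inner_map_map]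

theorem IsRandomOperator.covariant_selfAdjointPart (hA : IsRandomOperator A)
    (t : EuclideanSpace ℝ (Fin d)) (ω : Ω) (v : L2 (ω : ClosedSubset d)) :
    selfAdjointPart A (t +ᵥ ω) (translateUnitary t (ω : ClosedSubset d) v)
      = translateUnitary t (ω : ClosedSubset d) (selfAdjointPart A ω v) := by
  have hiff : IsSelfAdjoint (A (t +ᵥ ω)) ↔ IsSelfAdjoint (A ω) :=
    isSelfAdjoint_of_unitary (H' := L2 ((t +ᵥ ω : Ω) : ClosedSubset d))
      (translateUnitary t (ω : ClosedSubset d)) (hA.covariant t ω)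
  rw [selfAdjointPart, selfAdjointPart]
  by_cases hω : IsSelfAdjoint (A ω)
  · rw [if_pos hω, if_pos (hiff.2 hω)]
    exact hA.covariant t ω v
  · rw [if_neg hω, if_neg fun h => hω (hiff.1 h)]
    exact (map_zero (translateUnitary t (ω : ClosedSubset d))).symm

end RandomOperatorField

end DeloneOp

/-! ### The main theorem -/

theorem mainTheorem7 {d : ℕ} (hd : 1 ≤ d) {r R : ℝ} (hr : 0 < r) (hR : 0 < R)
    (Ω : SubAddAction (EuclideanSpace ℝ (Fin d)) (DeloneOp.ClosedSubset d))
    (hΩ : DeloneOp.IsDeloneSystem r R Ω)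
    (μ : Measure Ω) [IsProbabilityMeasure μ] [ErgodicVAdd (EuclideanSpace ℝ (Fin d)) Ω μ]
    (A : ∀ ω : Ω, DeloneOp.L2 (ω : DeloneOp.ClosedSubset d) →L[ℂ]
      DeloneOp.L2 (ω : DeloneOp.ClosedSubset d))
    (hA : DeloneOp.IsRandomOperator A) (hsa : ∀ᵐ ω ∂μ, IsSelfAdjoint (A ω)) :
    ∃ S Sac Ssc Spp Sess : Set ℝ, ∀ᵐ ω ∂μ,
      spectrum ℂ (A ω) = Complex.ofReal '' S ∧
      DeloneOp.acSpectrum (A ω) = Complex.ofReal '' Sac ∧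
      DeloneOp.scSpectrum (A ω) = Complex.ofReal '' Ssc ∧
      DeloneOp.ppSpectrum (A ω) = Complex.ofReal '' Spp ∧
      DeloneOp.essSpectrum (A ω) = Complex.ofReal '' Sess ∧
      DeloneOp.discSpectrum (A ω) = ∅ := by
  have hs : 0 < r / d := div_pos hr (by exact_mod_cast hd)
  have hinj : ∀ ω : Ω, Set.InjOn (DeloneOp.cellIndex (r / d))
      (ω : DeloneOp.ClosedSubset d).carrier :=
    fun ω => (hΩ.delone ω ω.2).injOn_cellIndex hd hr
  -- This makes the index set `ℤ^d` infinite, as the trace argument requires.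
  have : Nonempty (Fin d) := ⟨⟨0, hd⟩⟩
  obtain ⟨S, Sac, Ssc, Spp, Sess, h⟩ := (hA.isSelfAdjointField hs hinj).exists_ae_spectrum_eq
    (G := EuclideanSpace ℝ (Fin d)) μ
    (fun t ω => DeloneOp.translateUnitary t (ω : DeloneOp.ClosedSubset d))
    hA.covariant_selfAdjointPart
    -- Translation by the lattice vector `(l - k) r/d` moves cell `k` to cell `l` and shifts every
    -- index by `l - k`.
    (fun k l => ⟨WithLp.toLp 2 fun i => ((l - k) i : ℝ) * (r / d), Equiv.addRight (l - k),
      by simp, fun j ω =>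
        DeloneOp.translateUnitary_cellVector hs (hinj ω) (l - k) j
          (hinj ((WithLp.toLp 2 fun i => ((l - k) i : ℝ) * (r / d)) +ᵥ ω))⟩)
  refine ⟨S, Sac, Ssc, Spp, Sess, ?_⟩
  filter_upwards [h, hsa] with ω hω hωsa
  have hAω : DeloneOp.selfAdjointPart A ω = A ω := if_pos hωsa
  rwa [hAω] at hω
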